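/- Let $N\ge 1$ and $D_1,\dots,D_N\ge 1$ be integers and put $D=D_1+\dots+D_N$. Let $\lambda:\mathrm{Spin}(D)\to SO(D)$, $\lambda(x)v=xvx^{-1}$, be the two-fold covering. Let $\widetilde H=SO(D_1)\times\cdots\times SO(D_N)\subset SO(D)$ be the subgroup of block diagonal matrices, and let $\widetilde G=\mathrm{Spin}(D_1)\times\cdots\times\mathrm{Spin}(D_N)$ be regarded as a subgroup of $\mathrm{Spin}(D)$ inside $\mathrm{C\ell}(D)=\mathrm{C\ell}(D_1)\widehat\otimes\cdots\widehat\otimes\mathrm{C\ell}(D_N)$, i.e. as the group of all products $x_1\cdots x_N=x_1\otimes\cdots\otimes x_N$ with $x_i\in\mathrm{Spin}(D_i)$ (the image of the multiplication homomorphism from the direct product; for $N\ge 2$ that homomorphism is not injective). Then $\lambda(\widetilde G)\subset\widetilde H$. Let $(M,g)$ be an oriented smooth Riemannian manifold of dimension $D$, let $P_{SO}$ be its $SO(D)$-principal bundle of oriented orthonormal frames, and let a spin structure on $M$ be given, that is, a smooth $\mathrm{Spin}(D)$-principal bundle $P_{\mathrm{Spin}}\to M$ with a smooth bundle map $\lambda:P_{\mathrm{Spin}}\to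 P_{SO}$ over $\mathrm{id}_M$ such that $\lambda(pa)=\lambda(p)\lambda(a)$. Suppose that $P_{SO}$ reduces to $\widetilde H$: there are a smooth $\widetilde H$-principal bundle $P_{\widetilde H}\to M$ and a smooth $\widetilde H$-equivariant bundle map $\imath:P_{\widetilde H}\to P_{SO}$ over $\mathrm{id}_M$. Then the fibre product $$P_{\widetilde G}=\{(p,q)\in P_{\mathrm{Spin}}\times P_{\widetilde H}\mid \lambda(p)=\imath(q)\},\qquad (p,q)\,a=(pa,\,q\,\lambda(a))\quad(a\in\widetilde G),$$ is a smooth $\widetilde G$-principal bundle over $M$, and the projection $P_{\widetilde G}\to P_{\mathrm{Spin}}$, $(p,q)\mapsto p$, is a smooth $\widetilde G$-equivariant bundle map over $\mathrm{id}_M$, i.e. a reduction of $P_{\mathrm{Spin}}$ to $\widetilde G$. Moreover $(p,q)\mapsto q$ is a smooth bundle map $P_{\widetilde G}\to P_{\widetilde H}$ over $\mathrm{id}_M$ that is equivariant along $\lambda:\widetilde G\to\widetilde H$. -/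

import Mathlib

open CliffordAlgebra
open scoped Manifold ContDiff

noncomputable section

/-- The negative definite form `v ↦ -⟨v, v⟩` of `ℝⁿ`; its Clifford algebra `Cl(n)` has the relation
`v w + w v = -2 ⟨v, w⟩`. -/
abbrev stdForm (n : ℕ) : QuadraticForm ℝ (Fin n → ℝ) :=
  QuadraticMap.weightedSumSquares ℝ (fun _ : Fin n => (-1 : ℝ))

/-- The group `SO(n)`. -/
abbrev SOGroup (n : ℕ) : Type := Matrix.specialOrthogonalGroup (Fin n) ℝ

/-- The group `Spin(n)` in the Clifford algebra `Cl(n)`. -/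
abbrev SpinGroup (n : ℕ) : Type := spinGroup (stdForm n)


theorem stdForm_apply {n : ℕ} (v : Fin n → ℝ) : stdForm n v = - (v ⬝ᵥ v) := by
  simp [QuadraticMap.weightedSumSquares_apply, dotProduct]

theorem polar_stdForm {n : ℕ} (v w : Fin n → ℝ) :
    QuadraticMap.polar (stdForm n) v w = -2 * (v ⬝ᵥ w) := by
  simp only [QuadraticMap.polar, stdForm_apply, add_dotProduct, dotProduct_add]
  rw [dotProduct_comm w v]; ring

theorem clifford_ι_injective {n : ℕ} : Function.Injective (ι (stdForm n)) := by
  intro v w h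
  have h' := congrArg (CliffordAlgebra.equivExterior (stdForm n)) h
  simpa [CliffordAlgebra.equivExterior, CliffordAlgebra.changeFormEquiv, CliffordAlgebra.changeForm_ι,
    ExteriorAlgebra.ι_inj] using h'

theorem det_reflection_stdForm {n : ℕ} (a : Fin n → ℝ) (ha : a ⬝ᵥ a ≠ 0)
    (f : (Fin n → ℝ) →ₗ[ℝ] (Fin n → ℝ))
    (hf : ∀ v, f v = v - (2 * (a ⬝ᵥ v) / (a ⬝ᵥ a)) • a) : LinearMap.det f = -1 := by
  have h : LinearMap.toMatrix' f = 1 + Matrix.replicateCol Unit a *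
      Matrix.replicateRow Unit (-(2 / (a ⬝ᵥ a)) • a) := by
    ext i j
    rw [LinearMap.toMatrix'_apply, hf]
    simp [Matrix.mul_apply, Matrix.one_apply, Pi.single_apply, dotProduct]
    ring
  rw [← LinearMap.det_toMatrix', h, Matrix.det_one_add_replicateCol_mul_replicateRow,
    smul_dotProduct, smul_eq_mul]
  field_simp
  norm_num

theorem lipschitz_vector_aux {n : ℕ} (x : (CliffordAlgebra (stdForm n))ˣ)
    (hx : (x : CliffordAlgebra (stdForm n)) ∈ Set.range (ι (stdForm n))) :
    (x : CliffordAlgebra (stdForm n)) ∈ evenOdd (stdForm n) 1 ∧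
      ∃ f : (Fin n → ℝ) →ₗ[ℝ] (Fin n → ℝ), LinearMap.det f = -1 ∧
        ∀ v, ι (stdForm n) (f v) =
          involute (x : CliffordAlgebra (stdForm n)) * ι (stdForm n) v * ↑x⁻¹ := by
  obtain ⟨a, ha⟩ := hx
  refine ⟨ha ▸ ι_mem_evenOdd_one _ a, ?_⟩
  let _ := x.invertible
  let _ : Invertible (ι (stdForm n) a) := by rwa [ha]
  let _ : Invertible (stdForm n a) := invertibleOfInvertibleι (stdForm n) a
  have hQ : stdForm n a ≠ 0 := Invertible.ne_zero _
  have haa : a ⬝ᵥ a ≠ 0 := fun h => hQ (by rw [stdForm_apply, h, neg_zero])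
  let f : (Fin n → ℝ) →ₗ[ℝ] (Fin n → ℝ) :=
    LinearMap.id - (((2 / (a ⬝ᵥ a)) • dotProductBilin ℝ ℝ a).smulRight a)
  have hf : ∀ v, f v = v - (2 * (a ⬝ᵥ v) / (a ⬝ᵥ a)) • a := by
    intro v
    simp [f, dotProductBilin]
    ring_nf
  refine ⟨f, det_reflection_stdForm a haa f hf, fun v => ?_⟩
  have hinv : (↑x⁻¹ : CliffordAlgebra (stdForm n)) = ⅟(ι (stdForm n) a) := by
    exact (invOf_eq_right_inv (by rw [ha]; exact x.mul_inv)).symm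
  rw [hinv, ← ha, involute_ι, neg_mul, neg_mul, ι_mul_ι_mul_invOf_ι, ← map_neg, hf]
  congr 1
  rw [polar_stdForm, invOf_eq_inv, stdForm_apply, neg_sub]
  congr 2
  field_simp

theorem lipschitz_aux {n : ℕ} (x : (CliffordAlgebra (stdForm n))ˣ)
    (hx : x ∈ lipschitzGroup (stdForm n)) :
    ∃ k : ZMod 2, (x : CliffordAlgebra (stdForm n)) ∈ evenOdd (stdForm n) k ∧
      ∃ f : (Fin n → ℝ) →ₗ[ℝ] (Fin n → ℝ), LinearMap.det f = (if k = 0 then 1 else -1) ∧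
        ∀ v, ι (stdForm n) (f v) =
          involute (x : CliffordAlgebra (stdForm n)) * ι (stdForm n) v * ↑x⁻¹ := by
  unfold lipschitzGroup at hx
  induction hx using Subgroup.closure_induction'' with
  | mem x hx =>
    obtain ⟨h1, f, hf, h⟩ := lipschitz_vector_aux x hx
    exact ⟨1, h1, f, by simpa using hf, h⟩
  | inv_mem x hx =>
    have hx' : (↑x⁻¹ : CliffordAlgebra (stdForm n)) ∈ Set.range (ι (stdForm n)) := by
      obtain ⟨a, ha⟩ := hx
      let _ := x.invertible
      let _ : Invertible (ι (stdForm n) a) := by rwa [ha]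
      let _ : Invertible (stdForm n a) := invertibleOfInvertibleι (stdForm n) a
      refine ⟨⅟(stdForm n a) • a, ?_⟩
      rw [← invOf_ι]
      exact invOf_eq_right_inv (by rw [ha]; exact x.mul_inv)
    obtain ⟨h1, f, hf, h⟩ := lipschitz_vector_aux x⁻¹ hx'
    exact ⟨1, h1, f, by simpa using hf, h⟩
  | one => exact ⟨0, by simpa using Submodule.one_le.mp (one_le_evenOdd_zero (stdForm n)), LinearMap.id, by simp, by simp⟩
  | mul x y _ _ hx hy =>
    obtain ⟨k, hk, f, hf, h⟩ := hx
    obtain ⟨l, hl, f', hf', h'⟩ := hy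
    refine ⟨k + l, ?_, f ∘ₗ f', ?_, fun v => ?_⟩
    · rw [Units.val_mul]
      exact evenOdd_mul_le _ k l (Submodule.mul_mem_mul hk hl)
    · rw [LinearMap.det_comp, hf, hf']
      clear hk hl hf hf'
      revert k l
      have h2 : ∀ k l : ZMod 2, (k = 0 ∧ l = 0) ∨ (k = 0 ∧ l = 1) ∨ (k = 1 ∧ l = 0) ∨
        (k = 1 ∧ l = 1) := by decide
      intro k l
      have h3 : (1 + 1 : ZMod 2) = 0 := by decide
      rcases h2 k l with ⟨rfl, rfl⟩ | ⟨rfl, rfl⟩ | ⟨rfl, rfl⟩ | ⟨rfl, rfl⟩ <;> simp [h3]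
    · rw [LinearMap.comp_apply, h, h']
      simp [mul_assoc]

/-- Conjugation by a spin element is a linear map of determinant one. -/
theorem exists_spin_conj {n : ℕ} (g : SpinGroup n) :
    ∃ f : (Fin n → ℝ) →ₗ[ℝ] (Fin n → ℝ), LinearMap.det f = 1 ∧
      ∀ v, ι (stdForm n) (f v) = (g : CliffordAlgebra (stdForm n)) * ι (stdForm n) v *
        star (g : CliffordAlgebra (stdForm n)) := by
  obtain ⟨x, hx, hxg⟩ := pinGroup.mem_lipschitzGroup (spinGroup.mem_pin g.2)
  have hxg' : (x : CliffordAlgebra (stdForm n)) = g := hxg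
  obtain ⟨k, hk, f, hf, h⟩ := lipschitz_aux x hx
  have heven : (x : CliffordAlgebra (stdForm n)) ∈ evenOdd (stdForm n) 0 := by
    rw [hxg']; exact spinGroup.mem_even g.2
  have hinv : (↑x⁻¹ : CliffordAlgebra (stdForm n)) = star (g : CliffordAlgebra (stdForm n)) := by
    rw [Units.inv_eq_of_mul_eq_one_right]
    rw [hxg']; exact spinGroup.mul_star_self_of_mem g.2
  have hk0 : k = 0 := by
    by_contra hk0
    have : k = 1 := (by decide : ∀ k : ZMod 2, k ≠ 0 → k = 1) k hk0
    subst this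
    have h0 : (x : CliffordAlgebra (stdForm n)) = 0 :=
      Submodule.disjoint_def.1 (evenOdd_isCompl (stdForm n)).disjoint _ heven hk
    exact x.ne_zero h0
  refine ⟨f, by simp [hf, hk0], fun v => ?_⟩
  rw [h, hinv, hxg', spinGroup.involute_eq g.2]

/-- The linear map `v ↦ g v g⁻¹` of `ℝⁿ` for `g ∈ Spin(n)`. -/
def spinConj {n : ℕ} (g : SpinGroup n) : (Fin n → ℝ) →ₗ[ℝ] (Fin n → ℝ) :=
  (exists_spin_conj g).choose

theorem det_spinConj {n : ℕ} (g : SpinGroup n) : LinearMap.det (spinConj g) = 1 :=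
  (exists_spin_conj g).choose_spec.1

theorem ι_spinConj {n : ℕ} (g : SpinGroup n) (v : Fin n → ℝ) :
    ι (stdForm n) (spinConj g v) = (g : CliffordAlgebra (stdForm n)) * ι (stdForm n) v *
      ((g⁻¹ : SpinGroup n) : CliffordAlgebra (stdForm n)) :=
  (exists_spin_conj g).choose_spec.2 v

theorem spinConj_one {n : ℕ} : spinConj (1 : SpinGroup n) = LinearMap.id := by
  ext1 i
  apply LinearMap.ext_ring
  apply clifford_ι_injective
  simp [ι_spinConj]

theorem spinConj_mul {n : ℕ} (g h : SpinGroup n) :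
    spinConj (g * h) = spinConj g ∘ₗ spinConj h := by
  refine LinearMap.ext fun v => clifford_ι_injective ?_
  rw [LinearMap.comp_apply, ι_spinConj, ι_spinConj, ι_spinConj, mul_inv_rev]
  simp only [Submonoid.coe_mul, mul_assoc]

theorem stdForm_spinConj {n : ℕ} (g : SpinGroup n) (v : Fin n → ℝ) :
    stdForm n (spinConj g v) = stdForm n v := by
  have hg : ((g⁻¹ : SpinGroup n) : CliffordAlgebra (stdForm n)) * g = 1 :=
    congrArg Subtype.val (inv_mul_cancel g)
  have hg' : (g : CliffordAlgebra (stdForm n)) * ((g⁻¹ : SpinGroup n) : CliffordAlgebra (stdForm n)) = 1 :=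
    congrArg Subtype.val (mul_inv_cancel g)
  have h : algebraMap ℝ (CliffordAlgebra (stdForm n)) (stdForm n (spinConj g v)) =
      algebraMap ℝ (CliffordAlgebra (stdForm n)) (stdForm n v) := by
    rw [← ι_sq_scalar, ι_spinConj]
    calc _ = (g : CliffordAlgebra (stdForm n)) * ι (stdForm n) v *
        (((g⁻¹ : SpinGroup n) : CliffordAlgebra (stdForm n)) * g) * ι (stdForm n) v *
          ((g⁻¹ : SpinGroup n) : CliffordAlgebra (stdForm n)) := by simp only [mul_assoc]
      _ = (g : CliffordAlgebra (stdForm n)) * (ι (stdForm n) v * ι (stdForm n) v) *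
          ((g⁻¹ : SpinGroup n) : CliffordAlgebra (stdForm n)) := by
            rw [hg]; simp only [mul_assoc, one_mul]
      _ = _ := by rw [ι_sq_scalar, ← Algebra.commutes, mul_assoc, hg', mul_one]
  exact FaithfulSMul.algebraMap_injective _ _ h

theorem spinConj_dotProduct {n : ℕ} (g : SpinGroup n) (v w : Fin n → ℝ) :
    spinConj g v ⬝ᵥ spinConj g w = v ⬝ᵥ w := by
  have h : QuadraticMap.polar (stdForm n) (spinConj g v) (spinConj g w) =
      QuadraticMap.polar (stdForm n) v w := by
    simp only [QuadraticMap.polar, ← map_add, stdForm_spinConj]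
  simpa [polar_stdForm] using h

/-- The two-fold covering homomorphism `Spin(n) → SO(n)`, `g ↦ (v ↦ g v g⁻¹)`. -/
def spinCover (n : ℕ) : SpinGroup n →* SOGroup n where
  toFun g := ⟨LinearMap.toMatrix' (spinConj g), by
    rw [Matrix.mem_specialOrthogonalGroup_iff, Matrix.mem_orthogonalGroup_iff']
    refine ⟨?_, by rw [LinearMap.det_toMatrix', det_spinConj]⟩
    ext i j
    have h := spinConj_dotProduct g (Pi.single i 1) (Pi.single j 1)
    simpa [Matrix.mul_apply, LinearMap.toMatrix'_apply, dotProduct, Matrix.one_apply,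
      Pi.single_apply, eq_comm] using h⟩
  map_one' := Subtype.ext (by simp [spinConj_one])
  map_mul' g h := Subtype.ext (by simp [spinConj_mul, LinearMap.toMatrix'_comp])

section blocks

variable {N : ℕ} (D : Fin N → ℕ)

/-- The inclusion of the `i`-th factor into `ℝ^{D_1} ⊕ ⋯ ⊕ ℝ^{D_N} = ℝ^{D_1 + ⋯ + D_N}`, where the
coordinates of the summands are put one after the other. -/
def blockInclusion (i : Fin N) : (Fin (D i) → ℝ) →ₗ[ℝ] (Fin (∑ j, D j) → ℝ) where
  toFun v k := (Pi.single i v : ∀ j, Fin (D j) → ℝ)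
    (finSigmaFinEquiv.symm k).1 (finSigmaFinEquiv.symm k).2
  map_add' v w := by ext k; simp [Pi.single_add]
  map_smul' c v := by ext k; simp [Pi.single_smul]

theorem blockInclusion_apply (i : Fin N) (v : Fin (D i) → ℝ) (j : Fin N) (b : Fin (D j)) :
    blockInclusion D i v (finSigmaFinEquiv ⟨j, b⟩) = (Pi.single i v : ∀ j, Fin (D j) → ℝ) j b :=
  congrArg (fun s : (Σ j, Fin (D j)) => (Pi.single i v : ∀ j, Fin (D j) → ℝ) s.1 s.2)
    (finSigmaFinEquiv.symm_apply_apply ⟨j, b⟩)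

theorem blockInclusion_dotProduct_self (i : Fin N) (v w : Fin (D i) → ℝ) :
    blockInclusion D i v ⬝ᵥ blockInclusion D i w = v ⬝ᵥ w := by
  simp only [dotProduct, blockInclusion, LinearMap.coe_mk, AddHom.coe_mk]
  rw [Equiv.sum_comp finSigmaFinEquiv.symm (fun s : (Σ j, Fin (D j)) =>
    (Pi.single i v : ∀ j, Fin (D j) → ℝ) s.1 s.2 * (Pi.single i w : ∀ j, Fin (D j) → ℝ) s.1 s.2),
    Fintype.sum_sigma, Finset.sum_eq_single i]
  · simp
  · intro j _ hj; simp [Pi.single_eq_of_ne hj]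
  · simp

theorem blockInclusion_dotProduct_ne {i j : Fin N} (hij : i ≠ j) (v : Fin (D i) → ℝ)
    (w : Fin (D j) → ℝ) : blockInclusion D i v ⬝ᵥ blockInclusion D j w = 0 := by
  simp only [dotProduct, blockInclusion, LinearMap.coe_mk, AddHom.coe_mk]
  refine Finset.sum_eq_zero fun k _ => ?_
  by_cases h : (finSigmaFinEquiv.symm k).1 = i
  · rw [Pi.single_eq_of_ne (i := j) (fun h' => hij (h.symm.trans h'))]; simp
  · rw [Pi.single_eq_of_ne (i := i) h]; simp

/-- The inclusion of the `i`-th summand as an isometry of quadratic forms. -/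
def blockIsometry (i : Fin N) : stdForm (D i) →qᵢ stdForm (∑ j, D j) where
  toLinearMap := blockInclusion D i
  map_app' v := by
    change stdForm _ (blockInclusion D i v) = _
    rw [stdForm_apply, stdForm_apply, blockInclusion_dotProduct_self]

theorem blockIsometry_isOrtho {i j : Fin N} (hij : i ≠ j) (v : Fin (D i) → ℝ)
    (w : Fin (D j) → ℝ) :
    (stdForm (∑ k, D k)).IsOrtho (blockIsometry D i v) (blockIsometry D j w) := by
  have h : QuadraticMap.polar (stdForm (∑ k, D k)) (blockInclusion D i v)
      (blockInclusion D j w) = 0 := by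
    rw [polar_stdForm, blockInclusion_dotProduct_ne D hij, mul_zero]
  rw [QuadraticMap.polar, sub_sub, sub_eq_zero] at h
  exact h

theorem clifford_map_star {m n : ℕ} (f : stdForm m →qᵢ stdForm n) (x : CliffordAlgebra (stdForm m)) :
    CliffordAlgebra.map f (star x) = star (CliffordAlgebra.map f x) := by
  induction x using CliffordAlgebra.induction with
  | algebraMap r => simp [star_algebraMap]
  | ι v => simp [star_ι]
  | mul a b ha hb => simp [ha, hb]
  | add a b ha hb => simp [ha, hb]

theorem clifford_map_mem_evenOdd {m n : ℕ} (f : stdForm m →qᵢ stdForm n) (k : ZMod 2)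
    {x : CliffordAlgebra (stdForm m)} (hx : x ∈ evenOdd (stdForm m) k) :
    CliffordAlgebra.map f x ∈ evenOdd (stdForm n) k := by
  have h : (evenOdd (stdForm m) k).map (CliffordAlgebra.map f).toLinearMap ≤
      evenOdd (stdForm n) k := by
    unfold evenOdd
    rw [Submodule.map_iSup]
    refine iSup_mono fun i => ?_
    rw [Submodule.map_pow, ι_range_map_map]
    exact pow_le_pow_left' (by rintro _ ⟨a, _, rfl⟩; exact ⟨_, rfl⟩) _
  exact h (Submodule.mem_map_of_mem hx)

theorem clifford_map_mem_spinGroup {m n : ℕ} (f : stdForm m →qᵢ stdForm n)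
    {x : CliffordAlgebra (stdForm m)} (hx : x ∈ spinGroup (stdForm m)) :
    CliffordAlgebra.map f x ∈ spinGroup (stdForm n) := by
  refine spinGroup.mem_iff.2 ⟨pinGroup.mem_iff.2 ⟨?_, ?_⟩,
    clifford_map_mem_evenOdd f 0 (spinGroup.mem_even hx)⟩
  · obtain ⟨y, hy, rfl⟩ := pinGroup.mem_lipschitzGroup (spinGroup.mem_pin hx)
    refine ⟨Units.map (CliffordAlgebra.map f : _ →* CliffordAlgebra (stdForm n)) y, ?_, rfl⟩
    have h : lipschitzGroup (stdForm m) ≤ (lipschitzGroup (stdForm n)).comap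
        (Units.map (CliffordAlgebra.map f : _ →* CliffordAlgebra (stdForm n))) := by
      refine (Subgroup.closure_le _).2 ?_
      rintro u ⟨a, ha⟩
      refine Subgroup.subset_closure ⟨f a, ?_⟩
      rw [← map_apply_ι, ha]; rfl
    exact h hy
  · rw [Unitary.mem_iff, ← clifford_map_star, ← map_mul, ← map_mul,
      spinGroup.star_mul_self_of_mem hx, spinGroup.mul_star_self_of_mem hx]
    simp

/-- The inclusion `Spin(D_i) → Spin(D_1 + ⋯ + D_N)` of the `i`-th factor. -/
def spinInclusion (i : Fin N) : SpinGroup (D i) →* SpinGroup (∑ j, D j) where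
  toFun x := ⟨CliffordAlgebra.map (blockIsometry D i) x, clifford_map_mem_spinGroup _ x.2⟩
  map_one' := Subtype.ext (by simp)
  map_mul' x y := Subtype.ext (by simp)

theorem spinInclusion_commute : Pairwise fun i j : Fin N =>
    ∀ (x : SpinGroup (D i)) (y : SpinGroup (D j)),
      Commute (spinInclusion D i x) (spinInclusion D j y) := fun _ _ hij x y =>
  Subtype.ext (commute_map_mul_map_of_isOrtho_of_mem_evenOdd_zero_left _ _
    (blockIsometry_isOrtho D hij) _ _ (spinGroup.mem_even x.2) (spinGroup.mem_even y.2))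

/-- The multiplication homomorphism
`Spin(D_1) × ⋯ × Spin(D_N) → Spin(D_1 + ⋯ + D_N)`, `(x_1, …, x_N) ↦ x_1 ⋯ x_N`. -/
def spinProductHom : (∀ i, SpinGroup (D i)) →* SpinGroup (∑ i, D i) :=
  MonoidHom.noncommPiCoprod (spinInclusion D) (spinInclusion_commute D)

/-- The group `Spin(D_1) × ⋯ × Spin(D_N)` as a subgroup of `Spin(D_1 + ⋯ + D_N)`: all products
`x_1 ⋯ x_N` with `x_i ∈ Spin(D_i)`, that is, all `x_1 ⊗ ⋯ ⊗ x_N` in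
`Cl(D_1) ⊗ ⋯ ⊗ Cl(D_N) = Cl(D_1 + ⋯ + D_N)`. -/
def spinProduct : Subgroup (SpinGroup (∑ i, D i)) := (spinProductHom D).range

theorem det_blockDiagonal_prime (A : ∀ i, Matrix (Fin (D i)) (Fin (D i)) ℝ) :
    (Matrix.blockDiagonal' A).det = ∏ i, (A i).det := by
  rw [(Matrix.blockTriangular_blockDiagonal' A).det_fintype]
  refine Finset.prod_congr rfl fun i _ => ?_
  let e : {s : (Σ j, Fin (D j)) // s.1 = i} ≃ Fin (D i) := Equiv.sigmaSubtype i
  rw [← Matrix.det_submatrix_equiv_self e (A i)]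
  congr 1
  ext ⟨⟨j, a⟩, ha⟩ ⟨⟨k, b⟩, hb⟩
  obtain rfl : j = i := ha
  obtain rfl : k = j := hb
  simp [Matrix.toSquareBlock_def, Matrix.blockDiagonal'_apply_eq, e, Equiv.sigmaSubtype]

/-- The block diagonal homomorphism `SO(D_1) × ⋯ × SO(D_N) → SO(D_1 + ⋯ + D_N)`. -/
def soProductHom : (∀ i, SOGroup (D i)) →* SOGroup (∑ i, D i) where
  toFun A := ⟨Matrix.reindex finSigmaFinEquiv finSigmaFinEquiv
      (Matrix.blockDiagonal' fun i => (A i : Matrix (Fin (D i)) (Fin (D i)) ℝ)), by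
    rw [Matrix.mem_specialOrthogonalGroup_iff, Matrix.mem_orthogonalGroup_iff]
    constructor
    · have h : ∀ i, (A i : Matrix (Fin (D i)) (Fin (D i)) ℝ) * (A i : Matrix _ _ ℝ).transpose = 1 :=
        fun i => (Matrix.mem_orthogonalGroup_iff _ _).1 (A i).2.1
      simp only [Matrix.transpose_reindex, Matrix.blockDiagonal'_transpose]
      rw [← Matrix.coe_reindexAlgEquiv ℝ ℝ, ← map_mul,
        ← Matrix.blockDiagonal'_mul]
      simp only [h]
      rw [show (fun i => (1 : Matrix (Fin (D i)) (Fin (D i)) ℝ)) = 1 from rfl,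
        Matrix.blockDiagonal'_one, map_one]
    · have h : ∀ i, (A i : Matrix (Fin (D i)) (Fin (D i)) ℝ).det = 1 := fun i => (A i).2.2
      rw [Matrix.det_reindex_self, det_blockDiagonal_prime]
      simp [h]⟩
  map_one' := Subtype.ext (by
    change Matrix.reindex _ _ (Matrix.blockDiagonal'
      (1 : ∀ i, Matrix (Fin (D i)) (Fin (D i)) ℝ)) = 1
    rw [Matrix.blockDiagonal'_one, ← Matrix.coe_reindexAlgEquiv ℝ ℝ, map_one])
  map_mul' A B := Subtype.ext (by
    change Matrix.reindex _ _ (Matrix.blockDiagonal' fun i =>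
      (A i : Matrix (Fin (D i)) (Fin (D i)) ℝ) * (B i : Matrix (Fin (D i)) (Fin (D i)) ℝ)) =
      Matrix.reindex _ _ _ * Matrix.reindex _ _ _
    rw [Matrix.blockDiagonal'_mul, ← Matrix.coe_reindexAlgEquiv ℝ ℝ, map_mul])

/-- The group `SO(D_1) × ⋯ × SO(D_N)` as the subgroup of block diagonal matrices of
`SO(D_1 + ⋯ + D_N)`. -/
def soProduct : Subgroup (SOGroup (∑ i, D i)) := (soProductHom D).range

theorem single_eq_blockInclusion (i : Fin N) (a : Fin (D i)) :
    (Pi.single (finSigmaFinEquiv ⟨i, a⟩) 1 : Fin (∑ j, D j) → ℝ) =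
      blockInclusion D i (Pi.single a 1) := by
  ext k
  obtain ⟨⟨j, b⟩, rfl⟩ := finSigmaFinEquiv.surjective k
  rw [blockInclusion_apply]
  by_cases h : j = i
  · subst h
    simp [Pi.single_apply]
  · rw [Pi.single_eq_of_ne (i := i) h, Pi.single_eq_of_ne]
    · rfl
    · intro h'
      exact h (congrArg Sigma.fst (finSigmaFinEquiv.injective h'))

theorem linearMap_ext_blockInclusion {f g : (Fin (∑ j, D j) → ℝ) →ₗ[ℝ] (Fin (∑ j, D j) → ℝ)}
    (h : ∀ i v, f (blockInclusion D i v) = g (blockInclusion D i v)) : f = g := by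
  refine LinearMap.pi_ext' fun k => LinearMap.ext_ring ?_
  obtain ⟨⟨j, b⟩, rfl⟩ := finSigmaFinEquiv.surjective k
  simpa [single_eq_blockInclusion] using h j (Pi.single b 1)

theorem soProductHom_mulVec (A : ∀ i, SOGroup (D i)) (i : Fin N) (v : Fin (D i) → ℝ) :
    Matrix.mulVec (soProductHom D A : Matrix (Fin (∑ j, D j)) (Fin (∑ j, D j)) ℝ)
      (blockInclusion D i v) =
      blockInclusion D i (Matrix.mulVec (A i : Matrix (Fin (D i)) (Fin (D i)) ℝ) v) := by
  ext k
  obtain ⟨⟨j, b⟩, rfl⟩ := finSigmaFinEquiv.surjective k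
  rw [blockInclusion_apply]
  simp only [Matrix.mulVec, dotProduct, soProductHom, blockInclusion, LinearMap.coe_mk,
    AddHom.coe_mk, MonoidHom.coe_mk, OneHom.coe_mk, Matrix.reindex_apply, Matrix.submatrix_apply,
    Equiv.symm_apply_apply]
  rw [Equiv.sum_comp finSigmaFinEquiv.symm (fun s : (Σ j, Fin (D j)) =>
    Matrix.blockDiagonal' (fun i => (A i : Matrix (Fin (D i)) (Fin (D i)) ℝ)) ⟨j, b⟩ s *
      (Pi.single i v : ∀ j, Fin (D j) → ℝ) s.1 s.2), Fintype.sum_sigma, Finset.sum_eq_single i]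
  · by_cases h : j = i
    · subst h
      simp [Matrix.blockDiagonal'_apply_eq, Matrix.mulVec, dotProduct]
    · simp [Matrix.blockDiagonal'_apply_ne _ _ _ h, Pi.single_eq_of_ne h]
  · intro l _ hl
    simp [Pi.single_eq_of_ne hl]
  · simp

theorem spinConj_spinInclusion_same (i : Fin N) (x : SpinGroup (D i)) (v : Fin (D i) → ℝ) :
    spinConj (spinInclusion D i x) (blockInclusion D i v) = blockInclusion D i (spinConj x v) := by
  apply clifford_ι_injective
  have h1 : ∀ w : Fin (D i) → ℝ, ι (stdForm (∑ j, D j)) (blockInclusion D i w) =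
      CliffordAlgebra.map (blockIsometry D i) (ι (stdForm (D i)) w) :=
    fun w => (map_apply_ι (blockIsometry D i) w).symm
  rw [ι_spinConj, h1, h1, ι_spinConj, map_mul, map_mul, ← map_inv]
  rfl

theorem spinConj_spinInclusion_ne {i j : Fin N} (hij : i ≠ j) (x : SpinGroup (D i))
    (v : Fin (D j) → ℝ) :
    spinConj (spinInclusion D i x) (blockInclusion D j v) = blockInclusion D j v := by
  apply clifford_ι_injective
  have h1 : ι (stdForm (∑ j, D j)) (blockInclusion D j v) =
      CliffordAlgebra.map (blockIsometry D j) (ι (stdForm (D j)) v) :=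
    (map_apply_ι (blockIsometry D j) v).symm
  have h2 := commute_map_mul_map_of_isOrtho_of_mem_evenOdd_zero_left _ _
    (blockIsometry_isOrtho D hij) _ _ (spinGroup.mem_even x.2) (ι_mem_evenOdd_one _ v)
  have h3 : ((spinInclusion D i x : SpinGroup (∑ j, D j)) : CliffordAlgebra (stdForm (∑ j, D j))) *
      (((spinInclusion D i x)⁻¹ : SpinGroup (∑ j, D j)) :
        CliffordAlgebra (stdForm (∑ j, D j))) = 1 :=
    congrArg Subtype.val (mul_inv_cancel (spinInclusion D i x))
  have h4 : ((spinInclusion D i x : SpinGroup (∑ j, D j)) : CliffordAlgebra (stdForm (∑ j, D j))) =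
    CliffordAlgebra.map (blockIsometry D i) (x : CliffordAlgebra (stdForm (D i))) := rfl
  rw [ι_spinConj, h1, h4, h2.eq, mul_assoc, ← h4, h3, mul_one]

theorem spinCover_spinInclusion (i : Fin N) (x : SpinGroup (D i)) :
    spinCover _ (spinInclusion D i x) =
      soProductHom D (Pi.mulSingle i (spinCover (D i) x)) := by
  apply Subtype.ext
  apply Matrix.toLin'.injective
  refine linearMap_ext_blockInclusion D fun j v => ?_
  rw [Matrix.toLin'_apply, Matrix.toLin'_apply, soProductHom_mulVec]
  have h1 : ∀ {n : ℕ} (g : SpinGroup n) (w : Fin n → ℝ),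
      Matrix.mulVec (spinCover n g : Matrix (Fin n) (Fin n) ℝ) w = spinConj g w :=
    fun g w => LinearMap.toMatrix'_mulVec _ _
  rw [h1]
  by_cases hij : i = j
  · subst hij
    rw [spinConj_spinInclusion_same, Pi.mulSingle_eq_same, h1]
  · rw [spinConj_spinInclusion_ne D hij, Pi.mulSingle_eq_of_ne (Ne.symm hij)]
    simp

theorem spinCover_spinProductHom (x : ∀ i, SpinGroup (D i)) :
    spinCover _ (spinProductHom D x) = soProductHom D (fun i => spinCover (D i) (x i)) := by
  let F : (∀ i, SpinGroup (D i)) →* (∀ i, SOGroup (D i)) :=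
    { toFun := fun x i => spinCover (D i) (x i)
      map_one' := by ext1 i; simp
      map_mul' := fun x y => by ext1 i; simp }
  have h : (spinCover _).comp (spinProductHom D) = (soProductHom D).comp F := by
    refine MonoidHom.pi_ext fun i y => ?_
    simp only [MonoidHom.comp_apply, spinProductHom,
      MonoidHom.noncommPiCoprod_mulSingle]
    rw [spinCover_spinInclusion]
    congr 1
    ext1 j
    by_cases hij : j = i
    · subst hij; simp [F]
    · simp [F, Pi.mulSingle_eq_of_ne hij]
  exact DFunLike.congr_fun h x

/-- The restriction `Spin(D_1) ⋯ Spin(D_N) → SO(D_1) × ⋯ × SO(D_N)` of the covering. -/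
def spinProductCover : spinProduct D →* soProduct D :=
  ((spinCover _).comp (spinProduct D).subtype).codRestrict (soProduct D) (by
    rintro ⟨_, x, rfl⟩
    exact ⟨_, (spinCover_spinProductHom D x).symm⟩)

end blocks

section bundles

/-- A family of real functions on a group that determines which maps into it are smooth. -/
class SmoothCoordinates (G : Type*) where
  coordinates : Set (G → ℝ)

/-- The coordinates of `SO(n)` are the restrictions of the linear functionals of the matrix algebra:
`SO(n)` is an embedded submanifold of it, so these functions detect smoothness. -/
instance SOGroup.smoothCoordinates (n : ℕ) : SmoothCoordinates (SOGroup n) where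
  coordinates := {c | ∃ φ : Matrix (Fin n) (Fin n) ℝ →ₗ[ℝ] ℝ,
    c = fun g : SOGroup n => φ (g : Matrix (Fin n) (Fin n) ℝ)}

/-- The coordinates of `Spin(n)` are the restrictions of the linear functionals of `Cl(n)`:
`Spin(n)` is an embedded submanifold of this finite-dimensional algebra. -/
instance SpinGroup.smoothCoordinates (n : ℕ) : SmoothCoordinates (SpinGroup n) where
  coordinates := {c | ∃ φ : CliffordAlgebra (stdForm n) →ₗ[ℝ] ℝ,
    c = fun g : SpinGroup n => φ (g : CliffordAlgebra (stdForm n))}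

/-- A (closed, hence embedded) subgroup inherits the coordinates of the group. -/
instance Subgroup.smoothCoordinates {G : Type*} [Group G] [SmoothCoordinates G]
    (K : Subgroup G) : SmoothCoordinates K where
  coordinates := {c | ∃ c' ∈ SmoothCoordinates.coordinates (G := G), c = fun g : K => c' (g : G)}

variable {n : ℕ} {M : Type*} [TopologicalSpace M] [ChartedSpace (EuclideanSpace ℝ (Fin n)) M]

variable (n) in
/-- Smoothness on the set `U` of a map from an `n`-manifold to a group with coordinates. -/
def SmoothIntoGroup {G : Type*} [SmoothCoordinates G] (h : M → G) (U : Set M) : Prop :=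
  ∀ c ∈ SmoothCoordinates.coordinates (G := G),
    ContMDiffOn (𝓡 n) 𝓘(ℝ, ℝ) ∞ (fun x => c (h x)) U

/-- The data of a smooth principal bundle with total space `P`: the projection, the right action of
the structure group, and the smooth local sections `(U, s)`, where only the values of `s` on `U`
matter. The smooth structure of `P` is recorded by its smooth local sections: it is the one for
which the local trivializations `U × G → P`, `(x, a) ↦ s x · a`, are diffeomorphisms onto the
preimage of `U`. -/
structure PrincipalBundleData (M G P : Type*) where
  proj : P → M
  act : P → G → P
  smoothSections : Set (Set M × (M → P))

variable (n) in
/-- The data form a smooth principal `G`-bundle over the `n`-manifold `M`. -/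
structure IsPrincipalBundle {G P : Type*} [Group G] [SmoothCoordinates G]
    (B : PrincipalBundleData M G P) : Prop where
  act_one : ∀ p, B.act p 1 = p
  act_mul : ∀ p a b, B.act p (a * b) = B.act (B.act p a) b
  proj_act : ∀ p a, B.proj (B.act p a) = B.proj p
  /-- The action is free, and transitive on the fibres. -/
  existsUnique_act : ∀ p q, B.proj p = B.proj q → ∃! a, B.act p a = q
  isOpen : ∀ σ ∈ B.smoothSections, IsOpen σ.1
  proj_section : ∀ σ ∈ B.smoothSections, ∀ x ∈ σ.1, B.proj (σ.2 x) = x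
  /-- There are smooth sections around every point. -/
  exists_section : ∀ x, ∃ σ ∈ B.smoothSections, x ∈ σ.1
  /-- Any two smooth sections differ by a smooth map to the structure group, and every section that
  differs from all smooth sections by such maps is smooth. -/
  mem_smoothSections_iff : ∀ (V : Set M) (t : M → P), IsOpen V → (∀ x ∈ V, B.proj (t x) = x) →
    ((V, t) ∈ B.smoothSections ↔ ∀ σ ∈ B.smoothSections, ∃ h : M → G,
      SmoothIntoGroup n h (σ.1 ∩ V) ∧ ∀ x ∈ σ.1 ∩ V, t x = B.act (σ.2 x) (h x))

/-- A smooth bundle map over the identity of `M` that is equivariant along `φ : G → H`. An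
equivariant bundle map is smooth if and only if it maps smooth local sections to such. -/
structure IsPrincipalMorphism {M G H P Q : Type*} [Group G] [Group H] (φ : G →* H)
    (B : PrincipalBundleData M G P) (C : PrincipalBundleData M H Q) (f : P → Q) : Prop where
  proj_map : ∀ p, C.proj (f p) = B.proj p
  map_act : ∀ p a, f (B.act p a) = C.act (f p) (φ a)
  map_section : ∀ σ ∈ B.smoothSections, (σ.1, fun x => f (σ.2 x)) ∈ C.smoothSections

variable (n) in
/-- `f : Q → P` is a reduction of the `G`-bundle `P` to the subgroup `K`: `Q` is a smooth principal
`K`-bundle and `f` a smooth `K`-equivariant bundle map over the identity of the base. -/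
structure IsReduction {G P Q : Type*} [Group G] [SmoothCoordinates G] (K : Subgroup G)
    (C : PrincipalBundleData M K Q) (B : PrincipalBundleData M G P) (f : Q → P) : Prop where
  isPrincipalBundle : IsPrincipalBundle n C
  isPrincipalMorphism : IsPrincipalMorphism K.subtype C B f

/-- The fibre product `{(p, q) | lam p = i q}` of a `G`-bundle and a `K`-bundle over an `H`-bundle,
with the action `(p, q) · a = (p · a, q · ψ a)` of a subgroup `L` of `G` on which `φ : G → H`
restricts to `ψ : L → K`. A section is smooth if and only if both of its components are. -/
def fibreProduct {M G H P Q R : Type*} [Group G] [Group H] {φ : G →* H} {K : Subgroup H}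
    {L : Subgroup G} (ψ : L →* K) (hψ : ∀ a : L, (ψ a : H) = φ a)
    {B : PrincipalBundleData M G P} {C : PrincipalBundleData M K Q}
    {F : PrincipalBundleData M H R} {lam : P → R} {i : Q → R}
    (hlam : IsPrincipalMorphism φ B F lam) (hi : IsPrincipalMorphism K.subtype C F i) :
    PrincipalBundleData M L {z : P × Q // lam z.1 = i z.2} where
  proj z := B.proj z.1.1
  act z a := ⟨(B.act z.1.1 a, C.act z.1.2 (ψ a)), by
    rw [hlam.map_act, hi.map_act, z.2, Subgroup.coe_subtype, hψ]⟩
  smoothSections := {σ | (σ.1, fun x => (σ.2 x).1.1) ∈ B.smoothSections ∧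
    (σ.1, fun x => (σ.2 x).1.2) ∈ C.smoothSections}

end bundles

section frames

/-- The tuple `e` is a basis with the orientation `o`. -/
def IsPositiveBasis {n : ℕ} {V : Type*} [AddCommGroup V] [Module ℝ V]
    (o : Orientation ℝ V (Fin n)) (e : Fin n → V) : Prop :=
  ∃ b : Module.Basis (Fin n) ℝ V, ⇑b = e ∧ b.orientation = o

variable (n : ℕ) (M : Type*) [TopologicalSpace M] [ChartedSpace (EuclideanSpace ℝ (Fin n)) M]
  [IsManifold (𝓡 n) ∞ M]

/-- A smooth Riemannian metric on the `n`-manifold `M`. -/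
abbrev RiemannianMetricOn : Type _ :=
  Bundle.ContMDiffRiemannianMetric (𝓡 n) ∞ (EuclideanSpace ℝ (Fin n))
    (fun x : M => TangentSpace (𝓡 n) x)

/-- An orientation of the `n`-manifold `M`: orientations of the tangent spaces that are given by a
smooth local frame around every point. -/
structure ManifoldOrientation where
  orientationAt : ∀ x : M, Orientation ℝ (TangentSpace (𝓡 n) x) (Fin n)
  exists_frame : ∀ x : M, ∃ U : Set M, IsOpen U ∧ x ∈ U ∧
    ∃ e : Fin n → ∀ y : M, TangentSpace (𝓡 n) y,
      (∀ i, ContMDiffOn (𝓡 n) (𝓡 n).tangent ∞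
        (fun y => (⟨y, e i y⟩ : TangentBundle (𝓡 n) M)) U) ∧
      ∀ y ∈ U, IsPositiveBasis (orientationAt y) (fun i => e i y)

variable {n M}

/-- `e` is an oriented orthonormal frame of the tangent space at `x`. -/
structure IsOrientedOrthonormal (g : RiemannianMetricOn n M) (o : ManifoldOrientation n M) (x : M)
    (e : Fin n → TangentSpace (𝓡 n) x) : Prop where
  orthonormal : ∀ i j, g.inner x (e i) (e j) = if i = j then 1 else 0
  positive : IsPositiveBasis (o.orientationAt x) e

/-- The total space of the bundle of oriented orthonormal frames of `(M, g)`. -/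
def OrthonormalFrames (g : RiemannianMetricOn n M) (o : ManifoldOrientation n M) : Type _ :=
  Σ x : M, {e : Fin n → TangentSpace (𝓡 n) x // IsOrientedOrthonormal g o x e}

theorem IsPositiveBasis.mul {V : Type*} [AddCommGroup V] [Module ℝ V]
    {o : Orientation ℝ V (Fin n)} {e : Fin n → V} (he : IsPositiveBasis o e) (A : SOGroup n) :
    IsPositiveBasis o (fun j => ∑ i, (A : Matrix (Fin n) (Fin n) ℝ) i j • e i) := by
  obtain ⟨b, rfl, hb⟩ := he
  have _ : FiniteDimensional ℝ V := b.finiteDimensional_of_finite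
  have hdet : (A : Matrix (Fin n) (Fin n) ℝ).det = 1 := A.2.2
  have hdet' : LinearMap.det (Matrix.toLin b b (A : Matrix (Fin n) (Fin n) ℝ)) = 1 := by
    rw [LinearMap.det_toLin, hdet]
  let f : V ≃ₗ[ℝ] V := LinearMap.equivOfDetNeZero
    (Matrix.toLin b b (A : Matrix (Fin n) (Fin n) ℝ)) (by rw [hdet']; exact one_ne_zero)
  have hf : (f : V →ₗ[ℝ] V) = Matrix.toLin b b (A : Matrix (Fin n) (Fin n) ℝ) := rfl
  refine ⟨b.map f, ?_, ?_⟩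
  · ext j
    rw [Module.Basis.map_apply]
    exact Matrix.toLin_self b b (A : Matrix (Fin n) (Fin n) ℝ) j
  · rw [← hb, b.orientation_comp_linearEquiv_eq_iff_det_pos, hf, hdet']
    exact one_pos

theorem IsOrientedOrthonormal.mul {g : RiemannianMetricOn n M} {o : ManifoldOrientation n M}
    {x : M} {e : Fin n → TangentSpace (𝓡 n) x} (he : IsOrientedOrthonormal g o x e)
    (A : SOGroup n) : IsOrientedOrthonormal g o x
      (fun j => ∑ i, (A : Matrix (Fin n) (Fin n) ℝ) i j • e i) where
  positive := he.positive.mul A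
  orthonormal j k := by
    have hA : (A : Matrix (Fin n) (Fin n) ℝ).transpose * (A : Matrix (Fin n) (Fin n) ℝ) = 1 :=
      (Matrix.mem_orthogonalGroup_iff' _ _).1 A.2.1
    have h := congrFun (congrFun hA j) k
    rw [Matrix.mul_apply, Matrix.one_apply] at h
    rw [← h]
    simp [he.orthonormal, mul_comm]

/-- The bundle `P_SO` of oriented orthonormal frames of `(M, g)` with the right action
`(e · A)_j = ∑ i, A_ij e_i` of `SO(n)`; the smooth sections are the smooth frames. -/
def frameBundle (g : RiemannianMetricOn n M) (o : ManifoldOrientation n M) :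
    PrincipalBundleData M (SOGroup n) (OrthonormalFrames g o) where
  proj p := p.1
  act p A := ⟨p.1, ⟨_, p.2.2.mul A⟩⟩
  smoothSections := {σ | IsOpen σ.1 ∧ (∀ x ∈ σ.1, (σ.2 x).1 = x) ∧
    ∀ i, ContMDiffOn (𝓡 n) (𝓡 n).tangent ∞
      (fun x => (⟨(σ.2 x).1, (σ.2 x).2.1 i⟩ : TangentBundle (𝓡 n) M)) σ.1}

/-- A spin structure on the oriented Riemannian manifold `(M, g)`: a smooth principal
`Spin(n)`-bundle with a smooth bundle map `lam` to the bundle of oriented orthonormal frames that is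
equivariant along the covering `Spin(n) → SO(n)`. -/
structure IsSpinStructure (g : RiemannianMetricOn n M) (o : ManifoldOrientation n M) {P : Type*}
    (B : PrincipalBundleData M (SpinGroup n) P) (lam : P → OrthonormalFrames g o) : Prop where
  isPrincipalBundle : IsPrincipalBundle n B
  isPrincipalMorphism : IsPrincipalMorphism (spinCover n) B (frameBundle g o) lam

end frames

end

/-! Algebraically, the theorem rests on the fact that `spinProduct D` is the full preimage of
`soProduct D` under the covering (`mem_spinProduct_of_spinCover_mem`). If `(p, q)` and `(p', q')`
lie over the same point, then `p' = p a` and `q' = q b` with unique `a` and `b`. Since `SO` acts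
freely on frames, `a` covers the block diagonal matrix `b`, so `a` belongs to `spinProduct D`. The
preimage is computed from two properties of the covering. It is onto for each block, by writing a
rotation as a product of reflections (`spinCover_surjective`). Its kernel is `{1, -1}`, and `-1`
already lies in one factor.

Smoothness needs local sections of the fibre product. Given smooth sections `σ` of the spin bundle
and `τ` of the reduced bundle, the two resulting frames differ by a smooth map to `SO`, whose
entries are inner products of frame vectors (`frameBundle_exists_smooth_act`). If that map lifts
locally to a smooth map `k` to `Spin`, then `(σ k, τ)` is a section of the fibre product.

The local lift (`SmoothIntoGroup.exists_local_lift`) is explicit. For `y` even, averaging `y`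
successively with `e_j y e_j⁻¹` over all generators leaves a scalar. Replacing the left factor `e_j`
by `g e_j g⁻¹`, which is given by a column of the rotation matrix, and starting from `1 = g g⁻¹`
therefore yields a scalar multiple of `g`. This is `spinLift`, a polynomial in the matrix entries
with value `1` at the identity; near the identity it can be normalized by a square root. The same
formula determines the kernel. -/

open CliffordAlgebra
open scoped Manifold ContDiff

noncomputable section

/-! ### Generators of the Clifford algebra and its finite dimension. -/

section generators

variable {n : ℕ}

/-- The standard generators of `Cl(n)`. -/
def cliffordGen (i : Fin n) : CliffordAlgebra (stdForm n) := ι (stdForm n) (Pi.single i 1)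

theorem cliffordGen_mul_self (i : Fin n) : cliffordGen i * cliffordGen i = -1 := by
  rw [cliffordGen, ι_sq_scalar, stdForm_apply]
  simp

theorem cliffordGen_mul_of_ne {i j : Fin n} (h : i ≠ j) :
    cliffordGen i * cliffordGen j = -(cliffordGen j * cliffordGen i) := by
  rw [eq_neg_iff_add_eq_zero, cliffordGen, cliffordGen, ι_mul_ι_add_swap, polar_stdForm]
  simp [h]

theorem involute_cliffordGen (i : Fin n) : involute (cliffordGen i) = -cliffordGen i :=
  involute_ι _

theorem ι_eq_sum_cliffordGen (v : Fin n → ℝ) :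
    ι (stdForm n) v = ∑ i, v i • cliffordGen i := by
  conv_lhs => rw [← Finset.univ_sum_single v]
  rw [map_sum]
  refine Finset.sum_congr rfl fun i _ => ?_
  rw [cliffordGen, ← map_smul, ← Pi.single_smul, smul_eq_mul, mul_one]

/-- The subalgebra of `Cl(n)` generated by the generators with index in `T`. -/
def coordSubalgebra (T : Finset (Fin n)) : Subalgebra ℝ (CliffordAlgebra (stdForm n)) :=
  Algebra.adjoin ℝ (cliffordGen '' T)

theorem coordSubalgebra_univ :
    coordSubalgebra (Finset.univ : Finset (Fin n)) = ⊤ := by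
  rw [eq_top_iff]
  rintro x -
  induction x using CliffordAlgebra.induction with
  | algebraMap r => exact Subalgebra.algebraMap_mem _ r
  | ι v =>
    rw [ι_eq_sum_cliffordGen]
    exact sum_mem fun i _ => Subalgebra.smul_mem _
      (Algebra.subset_adjoin (Set.mem_image_of_mem _ (Finset.mem_coe.2 (Finset.mem_univ i)))) _
  | mul a b ha hb => exact mul_mem ha hb
  | add a b ha hb => exact add_mem ha hb

theorem involute_mem_coordSubalgebra {T : Finset (Fin n)} {x : CliffordAlgebra (stdForm n)}
    (hx : x ∈ coordSubalgebra T) : involute x ∈ coordSubalgebra T := by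
  have h : coordSubalgebra T ≤ (coordSubalgebra T).comap involute := by
    refine Algebra.adjoin_le ?_
    rintro _ ⟨i, hi, rfl⟩
    simp only [Subalgebra.coe_comap, Set.mem_preimage, involute_cliffordGen, SetLike.mem_coe]
    exact neg_mem (Algebra.subset_adjoin ⟨i, hi, rfl⟩)
  exact h hx

/-- Each generator other than `e_j` that `e_j` passes contributes a sign, and `involute` collects
these signs. -/
theorem mul_cliffordGen_of_mem_coordSubalgebra {T : Finset (Fin n)} {j : Fin n} (hj : j ∉ T)
    {x : CliffordAlgebra (stdForm n)} (hx : x ∈ coordSubalgebra T) :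
    x * cliffordGen j = cliffordGen j * involute x := by
  unfold coordSubalgebra at hx
  induction hx using Algebra.adjoin_induction with
  | mem x hx =>
    obtain ⟨i, hi, rfl⟩ := hx
    rw [involute_cliffordGen, mul_neg]
    exact cliffordGen_mul_of_ne fun h => hj (h ▸ hi)
  | algebraMap r => rw [AlgHom.commutes, Algebra.commutes]
  | add x y _ _ hx hy => rw [add_mul, hx, hy, map_add, mul_add]
  | mul x y _ _ hx hy => rw [mul_assoc, hy, ← mul_assoc, hx, map_mul, mul_assoc]

/-- Elements of this shape are closed under products: `e_j` can be moved to the left at the cost of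
an involution, and `e_j² = -1`. Uniqueness of `a` and `b` is neither shown nor needed later. -/
theorem exists_of_mem_coordSubalgebra_insert {T : Finset (Fin n)} {j : Fin n} (hj : j ∉ T)
    {x : CliffordAlgebra (stdForm n)} (hx : x ∈ coordSubalgebra (insert j T)) :
    ∃ a ∈ coordSubalgebra T, ∃ b ∈ coordSubalgebra T, x = a + cliffordGen j * b := by
  unfold coordSubalgebra at hx
  induction hx using Algebra.adjoin_induction with
  | mem x hx =>
    obtain ⟨i, hi, rfl⟩ := hx
    rcases Finset.mem_insert.1 hi with rfl | hi
    · exact ⟨0, zero_mem _, 1, one_mem _, by simp⟩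
    · exact ⟨_, Algebra.subset_adjoin ⟨i, hi, rfl⟩, 0, zero_mem _, by simp⟩
  | algebraMap r => exact ⟨_, Subalgebra.algebraMap_mem _ r, 0, zero_mem _, by simp⟩
  | add x y _ _ hx hy =>
    obtain ⟨a, ha, b, hb, rfl⟩ := hx
    obtain ⟨a', ha', b', hb', rfl⟩ := hy
    exact ⟨_, add_mem ha ha', _, add_mem hb hb', by rw [mul_add]; abel⟩
  | mul x y _ _ hx hy =>
    obtain ⟨a, ha, b, hb, rfl⟩ := hx
    obtain ⟨a', ha', b', hb', rfl⟩ := hy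
    refine ⟨a * a' - involute b * b',
      sub_mem (mul_mem ha ha') (mul_mem (involute_mem_coordSubalgebra hb) hb'),
      involute a * b' + b * a',
      add_mem (mul_mem (involute_mem_coordSubalgebra ha) hb') (mul_mem hb ha'), ?_⟩
    have h1 := mul_cliffordGen_of_mem_coordSubalgebra hj ha
    have h2 := mul_cliffordGen_of_mem_coordSubalgebra hj hb
    calc (a + cliffordGen j * b) * (a' + cliffordGen j * b')
        = a * a' + (a * cliffordGen j) * b' + cliffordGen j * (b * a') +
          cliffordGen j * (b * cliffordGen j) * b' := by noncomm_ring
      _ = a * a' + cliffordGen j * (involute a * b') + cliffordGen j * (b * a') +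
          (cliffordGen j * cliffordGen j) * (involute b * b') := by
          rw [h1, h2]; simp only [mul_assoc]
      _ = _ := by rw [cliffordGen_mul_self]; noncomm_ring

theorem finite_coordSubalgebra (T : Finset (Fin n)) :
    (Subalgebra.toSubmodule (coordSubalgebra T)).FG := by
  induction T using Finset.induction_on with
  | empty =>
    rw [coordSubalgebra, Finset.coe_empty, Set.image_empty, Algebra.adjoin_empty]
    exact Algebra.toSubmodule_bot (R := ℝ) (A := CliffordAlgebra (stdForm n)) ▸
      Submodule.one_eq_span (R := ℝ) (A := CliffordAlgebra (stdForm n)) ▸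
        Submodule.fg_span_singleton _
  | insert j T hj ih =>
    have hfg := ih.sup (ih.map (LinearMap.mulLeft ℝ (cliffordGen j)))
    have _ := Module.Finite.iff_fg.2 hfg
    refine Module.Finite.iff_fg.1 (Submodule.finiteDimensional_of_le
      (S₂ := Subalgebra.toSubmodule (coordSubalgebra T) ⊔ (Subalgebra.toSubmodule (coordSubalgebra T)).map (LinearMap.mulLeft ℝ (cliffordGen j))) ?_)
    intro x hx
    obtain ⟨a, ha, b, hb, rfl⟩ := exists_of_mem_coordSubalgebra_insert hj hx
    exact Submodule.add_mem_sup ha ⟨b, hb, rfl⟩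

/-- Needed so that products of smooth maps to the Clifford algebra can be expanded in a finite
basis. -/
instance finiteDimensional_clifford : FiniteDimensional ℝ (CliffordAlgebra (stdForm n)) :=
  ⟨by
    have h := finite_coordSubalgebra (Finset.univ : Finset (Fin n))
    rwa [coordSubalgebra_univ, Algebra.top_toSubmodule] at h⟩

end generators

/-! ### Averaging over the generators, and the kernel of the covering. -/

section averaging

variable {n : ℕ}

/-- The composition over the list `l` of the maps `y ↦ (y + a_j y e_j⁻¹) / 2`. -/
def twistedAverage (a : Fin n → CliffordAlgebra (stdForm n)) (l : List (Fin n))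
    (y : CliffordAlgebra (stdForm n)) : CliffordAlgebra (stdForm n) :=
  l.foldl (fun y j => (2⁻¹ : ℝ) • (y - a j * y * cliffordGen j)) y

theorem twistedAverage_cons (a : Fin n → CliffordAlgebra (stdForm n)) (j : Fin n)
    (l : List (Fin n)) (y : CliffordAlgebra (stdForm n)) :
    twistedAverage a (j :: l) y =
      twistedAverage a l ((2⁻¹ : ℝ) • (y - a j * y * cliffordGen j)) := rfl

theorem twistedAverage_cliffordGen_one (l : List (Fin n)) :
    twistedAverage cliffordGen l 1 = 1 := by
  induction l with
  | nil => rfl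
  | cons j l ih =>
    rw [twistedAverage_cons, mul_one, cliffordGen_mul_self, sub_neg_eq_add,
      ← two_smul ℝ (1 : CliffordAlgebra (stdForm n)), smul_smul]
    norm_num [ih]

/-- Averaging an even element over the generators leaves a scalar. -/
theorem twistedAverage_cliffordGen_mem_bot {l : List (Fin n)} (hl : l.Nodup)
    {x : CliffordAlgebra (stdForm n)} (hx : x ∈ coordSubalgebra l.toFinset)
    (hx' : involute x = x) :
    twistedAverage cliffordGen l x ∈ (⊥ : Subalgebra ℝ (CliffordAlgebra (stdForm n))) := by
  induction l generalizing x with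
  | nil => simpa [coordSubalgebra, twistedAverage] using hx
  | cons j l ih =>
    rw [twistedAverage_cons]
    obtain ⟨hj, hl⟩ := List.nodup_cons.1 hl
    have hj' : j ∉ l.toFinset := by simpa using hj
    rw [List.toFinset_cons] at hx
    obtain ⟨a, ha, b, hb, rfl⟩ := exists_of_mem_coordSubalgebra_insert hj' hx
    -- Evenness of `x = a + e_j b` should make `a` even and `b` odd, so that conjugation by `e_j`
    -- fixes `a` and negates `e_j b`. Without uniqueness of the decomposition this is not available
    -- directly. Instead `x` is conjugated in both of its forms, as written and after `involute`;
    -- comparing the results gives `e_j (b + involute b) = 0`.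
    have h4 : involute a + -(cliffordGen j * involute b) = a + cliffordGen j * b := by
      rw [← hx', map_add, map_mul, involute_cliffordGen, neg_mul]
    have h5 : ∀ a ∈ coordSubalgebra l.toFinset, ∀ b ∈ coordSubalgebra l.toFinset,
        cliffordGen j * (a + cliffordGen j * b) * cliffordGen j =
          -(involute a + cliffordGen j * involute b) := by
      intro a ha b hb
      calc _ = cliffordGen j * (a * cliffordGen j) +
            (cliffordGen j * cliffordGen j) * (b * cliffordGen j) := by noncomm_ring
        _ = (cliffordGen j * cliffordGen j) * involute a +
            (cliffordGen j * cliffordGen j) * (cliffordGen j * involute b) := by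
              rw [mul_cliffordGen_of_mem_coordSubalgebra hj' ha,
                mul_cliffordGen_of_mem_coordSubalgebra hj' hb, ← mul_assoc]
        _ = _ := by rw [cliffordGen_mul_self]; noncomm_ring
    have h6 := h5 _ (involute_mem_coordSubalgebra ha) _
      (neg_mem (involute_mem_coordSubalgebra hb))
    rw [mul_neg, h4, h5 a ha b hb, map_neg, involute_involute, involute_involute, mul_neg,
      neg_inj] at h6
    have h7 : (2⁻¹ : ℝ) • (a + cliffordGen j * b -
        cliffordGen j * (a + cliffordGen j * b) * cliffordGen j) =
        (2⁻¹ : ℝ) • (a + involute a) := by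
      rw [h5 a ha b hb]
      linear_combination (norm := module) (4⁻¹ : ℝ) • h6 - (4⁻¹ : ℝ) • h4
    -- The `e_j` part has disappeared; what remains is again even and involves only the later
    -- generators.
    rw [h7]
    refine ih hl (Subalgebra.smul_mem _ (add_mem ha (involute_mem_coordSubalgebra ha)) _) ?_
    rw [map_smul, map_add, involute_involute, add_comm]

/-- In `(g e_j g') (g y) e_j` the inner factors cancel, so left multiplication by `g` passes through
every averaging step. -/
theorem twistedAverage_conj {g g' : CliffordAlgebra (stdForm n)} (hg : g' * g = 1)
    {a : Fin n → CliffordAlgebra (stdForm n)} (ha : ∀ j, a j = g * cliffordGen j * g')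
    (l : List (Fin n)) (y : CliffordAlgebra (stdForm n)) :
    twistedAverage a l (g * y) = g * twistedAverage cliffordGen l y := by
  induction l generalizing y with
  | nil => rfl
  | cons j l ih =>
    rw [twistedAverage_cons, twistedAverage_cons, ← ih]
    congr 1
    rw [ha, mul_smul_comm, mul_sub]
    congr 2
    calc _ = g * cliffordGen j * (g' * g) * y * cliffordGen j := by simp only [mul_assoc]
      _ = _ := by rw [hg]; simp only [mul_assoc, mul_one]

/-- A polynomial map from matrices to `Cl(n)` that maps `spinCover n g` to a multiple of `g`. -/
def spinLift (A : Matrix (Fin n) (Fin n) ℝ) : CliffordAlgebra (stdForm n) :=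
  twistedAverage (fun j => ∑ i, A i j • cliffordGen i) (List.finRange n) 1

theorem spinLift_one : spinLift (1 : Matrix (Fin n) (Fin n) ℝ) = 1 := by
  have h : (fun j : Fin n => ∑ i, (1 : Matrix (Fin n) (Fin n) ℝ) i j • cliffordGen i) =
      cliffordGen := by
    ext1 j
    simp [Matrix.one_apply]
  rw [spinLift, h, twistedAverage_cliffordGen_one]

theorem sum_spinCover_smul_cliffordGen (g : SpinGroup n) (j : Fin n) :
    ∑ i, (spinCover n g : Matrix (Fin n) (Fin n) ℝ) i j • cliffordGen i =
      (g : CliffordAlgebra (stdForm n)) * cliffordGen j *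
        ((g⁻¹ : SpinGroup n) : CliffordAlgebra (stdForm n)) := by
  rw [cliffordGen, ← ι_spinConj, ι_eq_sum_cliffordGen]
  refine Finset.sum_congr rfl fun i _ => ?_
  congr 1

/-- The starting value is `1 = g g⁻¹`; taking `g` out leaves the ordinary average of the even
element `g⁻¹`, which is the scalar `c`. It may be zero, so `spinLift` recovers `g` only where it
does not vanish. -/
theorem spinLift_spinCover (g : SpinGroup n) :
    ∃ c : ℝ, spinLift (spinCover n g : Matrix (Fin n) (Fin n) ℝ) =
      c • (g : CliffordAlgebra (stdForm n)) := by
  have h1 : ((g⁻¹ : SpinGroup n) : CliffordAlgebra (stdForm n)) * g = 1 :=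
    congrArg Subtype.val (inv_mul_cancel g)
  have h2 : (g : CliffordAlgebra (stdForm n)) *
      ((g⁻¹ : SpinGroup n) : CliffordAlgebra (stdForm n)) = 1 :=
    congrArg Subtype.val (mul_inv_cancel g)
  have h3 := twistedAverage_conj h1 (sum_spinCover_smul_cliffordGen g) (List.finRange n)
    ((g⁻¹ : SpinGroup n) : CliffordAlgebra (stdForm n))
  rw [h2] at h3
  have h4 := twistedAverage_cliffordGen_mem_bot (List.nodup_finRange n)
    (x := ((g⁻¹ : SpinGroup n) : CliffordAlgebra (stdForm n)))
    (by rw [List.toFinset_finRange, coordSubalgebra_univ]; trivial)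
    (spinGroup.involute_eq (g⁻¹).2)
  obtain ⟨c, hc⟩ := Algebra.mem_bot.1 h4
  refine ⟨c, ?_⟩
  rw [spinLift, h3, ← hc, ← Algebra.commutes, Algebra.smul_def]

/-- This makes `c²` computable from the multiple `c • g` alone, which is what allows normalization
up to sign. -/
theorem mul_star_smul_spin (g : SpinGroup n) (c : ℝ) :
    (c • (g : CliffordAlgebra (stdForm n))) * star (c • (g : CliffordAlgebra (stdForm n))) =
      algebraMap ℝ _ (c * c) := by
  rw [CliffordAlgebra.star_smul, smul_mul_smul_comm, spinGroup.mul_star_self_of_mem g.2,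
    Algebra.algebraMap_eq_smul_one]

/-- The kernel of the covering consists of `1` and `-1`. -/
theorem eq_one_or_neg_one_of_spinCover_eq_one {g : SpinGroup n} (hg : spinCover n g = 1) :
    (g : CliffordAlgebra (stdForm n)) = 1 ∨ (g : CliffordAlgebra (stdForm n)) = -1 := by
  obtain ⟨c, hc⟩ := spinLift_spinCover g
  rw [hg, OneMemClass.coe_one, spinLift_one] at hc
  have h := mul_star_smul_spin g c
  rw [← hc, star_one, mul_one, ← map_one (algebraMap ℝ (CliffordAlgebra (stdForm n)))] at h
  have h' := FaithfulSMul.algebraMap_injective _ _ h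
  rcases mul_self_eq_one_iff.1 h'.symm with rfl | rfl
  · left; rw [hc, one_smul]
  · right; rw [hc, neg_smul, one_smul, neg_neg]

end averaging

/-! ### Surjectivity of the covering. -/

section surjectivity

variable {n : ℕ}

/-- A unit vector `u` acts by twisted conjugation `w ↦ u w u` as the reflection in its orthogonal
complement, and `u² = -1` makes it unitary. -/
theorem exists_pin_of_prod_reflection (l : List (EuclideanSpace ℝ (Fin n))) :
    ∃ x : (CliffordAlgebra (stdForm n))ˣ, x ∈ lipschitzGroup (stdForm n) ∧
      (x : CliffordAlgebra (stdForm n)) ∈ unitary (CliffordAlgebra (stdForm n)) ∧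
      ∀ w : EuclideanSpace ℝ (Fin n),
        ι (stdForm n) ((l.map fun v => (ℝ ∙ v)ᗮ.reflection).prod w).ofLp =
          involute (x : CliffordAlgebra (stdForm n)) * ι (stdForm n) w.ofLp * ↑x⁻¹ := by
  induction l with
  | nil => exact ⟨1, one_mem _, one_mem _, fun w => by simp⟩
  | cons v l ih =>
    obtain ⟨x, hx, hx', h⟩ := ih
    -- The list may contain zero vectors, whose reflection is the identity and contributes no
    -- factor.
    by_cases hv : v = 0
    · subst hv
      refine ⟨x, hx, hx', fun w => ?_⟩
      rw [← h, List.map_cons, List.prod_cons]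
      rw [LinearIsometryEquiv.coe_mul, Function.comp_apply,
        Submodule.reflection_orthogonal_apply, Submodule.reflection_singleton_apply]
      simp
    · let u : EuclideanSpace ℝ (Fin n) := ‖v‖⁻¹ • v
      have hv' : ‖v‖ ≠ 0 := norm_ne_zero_iff.2 hv
      have hvv : v.ofLp ⬝ᵥ v.ofLp = ‖v‖ ^ 2 := by
        rw [← real_inner_self_eq_norm_sq, EuclideanSpace.inner_eq_star_dotProduct, star_trivial]
      have huu : u.ofLp ⬝ᵥ u.ofLp = 1 := by
        simp only [u, WithLp.ofLp_smul, smul_dotProduct, dotProduct_smul, hvv, smul_eq_mul]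
        field_simp
      have hsq : ι (stdForm n) u.ofLp * ι (stdForm n) u.ofLp = -1 := by
        rw [ι_sq_scalar, stdForm_apply, huu, map_neg, map_one]
      let y : (CliffordAlgebra (stdForm n))ˣ :=
        ⟨ι (stdForm n) u.ofLp, -ι (stdForm n) u.ofLp, by rw [mul_neg, hsq, neg_neg],
          by rw [neg_mul, hsq, neg_neg]⟩
      refine ⟨y * x, mul_mem (Subgroup.subset_closure ⟨_, rfl⟩) hx, ?_, fun w => ?_⟩
      · rw [Units.val_mul]
        refine mul_mem ?_ hx'
        rw [Unitary.mem_iff]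
        simp [y, star_ι, hsq]
      · rw [List.map_cons, List.prod_cons, Units.val_mul, map_mul, mul_inv_rev, Units.val_mul]
        have h1 : involute (y : CliffordAlgebra (stdForm n)) * involute ↑x * ι (stdForm n) w.ofLp *
            ((↑x⁻¹ : CliffordAlgebra (stdForm n)) * (↑y⁻¹ : CliffordAlgebra (stdForm n))) =
              ι (stdForm n) u.ofLp * (involute ↑x * ι (stdForm n) w.ofLp *
                (↑x⁻¹ : CliffordAlgebra (stdForm n))) * ι (stdForm n) u.ofLp := by
          change involute (ι (stdForm n) u.ofLp) * _ * _ * (_ * -ι (stdForm n) u.ofLp) = _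
          simp [mul_assoc]
        rw [h1, ← h, ι_mul_ι_mul_ι, polar_stdForm, stdForm_apply, huu]
        congr 1
        rw [LinearIsometryEquiv.coe_mul, Function.comp_apply,
          Submodule.reflection_orthogonal_apply, Submodule.reflection_singleton_apply,
          EuclideanSpace.inner_eq_star_dotProduct, star_trivial]
        ext i
        simp only [u, WithLp.ofLp_neg, WithLp.ofLp_sub, WithLp.ofLp_smul, Pi.neg_apply,
          Pi.sub_apply, Pi.smul_apply, smul_dotProduct, smul_eq_mul, dotProduct_comm v.ofLp,
          RCLike.ofReal_real_eq_id, id, two_smul, Pi.add_apply, WithLp.ofLp_add]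
        field_simp
        ring

theorem spinCover_mulVec (g : SpinGroup n) (w : Fin n → ℝ) :
    Matrix.mulVec (spinCover n g : Matrix (Fin n) (Fin n) ℝ) w = spinConj g w :=
  LinearMap.toMatrix'_mulVec _ _

/-- A rotation is a product of reflections, hence comes from a pin element. Determinant one forces
that element to be even, and on even elements twisted conjugation is ordinary conjugation. -/
theorem spinCover_surjective : Function.Surjective (spinCover n) := by
  intro A
  have hA : (A : Matrix (Fin n) (Fin n) ℝ).transpose * (A : Matrix (Fin n) (Fin n) ℝ) = 1 :=
    (Matrix.mem_orthogonalGroup_iff' _ _).1 A.2.1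
  let f : EuclideanSpace ℝ (Fin n) →ₗᵢ[ℝ] EuclideanSpace ℝ (Fin n) :=
    (Matrix.toEuclideanLin (A : Matrix (Fin n) (Fin n) ℝ)).isometryOfInner fun x y => by
      simp only [EuclideanSpace.inner_eq_star_dotProduct, star_trivial,
        Matrix.ofLp_toLpLin, Matrix.toLin'_apply]
      rw [Matrix.dotProduct_mulVec, ← Matrix.mulVec_transpose, Matrix.mulVec_mulVec, hA,
        Matrix.one_mulVec]
  obtain ⟨l, -, hl⟩ := (f.toLinearIsometryEquiv rfl).reflections_generate_dim
  obtain ⟨x, hx, hx', h⟩ := exists_pin_of_prod_reflection l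
  rw [← hl] at h
  obtain ⟨k, hk, φ, hφ, hφ'⟩ := lipschitz_aux x hx
  have hφA : ∀ v, φ v = Matrix.mulVec (A : Matrix (Fin n) (Fin n) ℝ) v := fun v =>
    clifford_ι_injective ((hφ' v).trans (h (WithLp.toLp 2 v)).symm)
  have hφA' : φ = Matrix.toLin' (A : Matrix (Fin n) (Fin n) ℝ) := LinearMap.ext hφA
  have hdet : (A : Matrix (Fin n) (Fin n) ℝ).det = 1 := A.2.2
  have hk0 : k = 0 := by
    by_contra hk0
    rw [hφA', LinearMap.det_toLin', hdet, if_neg hk0] at hφ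
    norm_num at hφ
  subst hk0
  let g : SpinGroup n := ⟨x, spinGroup.mem_iff.2
    ⟨pinGroup.mem_iff.2 ⟨⟨x, hx, rfl⟩, hx'⟩, hk⟩⟩
  have hinv : (↑x⁻¹ : CliffordAlgebra (stdForm n)) =
      ((g⁻¹ : SpinGroup n) : CliffordAlgebra (stdForm n)) :=
    Units.inv_eq_of_mul_eq_one_right (congrArg Subtype.val (mul_inv_cancel g))
  refine ⟨g, Subtype.ext (Matrix.toLin'.injective (LinearMap.ext fun v => ?_))⟩
  rw [Matrix.toLin'_apply, Matrix.toLin'_apply, spinCover_mulVec, ← hφA]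
  apply clifford_ι_injective
  rw [ι_spinConj, hφ', hinv, ← spinGroup.involute_eq g.2]

/-- For `n > 0` there is an element `-1` in `Spin(n)`. -/
theorem neg_one_mem_spinGroup (hn : 0 < n) :
    (-1 : CliffordAlgebra (stdForm n)) ∈ spinGroup (stdForm n) := by
  let e : CliffordAlgebra (stdForm n) := cliffordGen ⟨0, hn⟩
  have hsq : e * e = -1 := cliffordGen_mul_self _
  let y : (CliffordAlgebra (stdForm n))ˣ :=
    ⟨e, -e, by rw [mul_neg, hsq, neg_neg], by rw [neg_mul, hsq, neg_neg]⟩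
  refine spinGroup.mem_iff.2 ⟨pinGroup.mem_iff.2 ⟨⟨y * y,
    mul_mem (Subgroup.subset_closure ⟨_, rfl⟩) (Subgroup.subset_closure ⟨_, rfl⟩), hsq⟩, ?_⟩,
    neg_mem (one_mem _)⟩
  rw [Unitary.mem_iff]
  simp

end surjectivity

/-! ### The preimage of the block diagonal group. -/

section blocks

variable {N : ℕ} (D : Fin N → ℕ)

theorem mem_spinProduct_of_spinCover_eq_one (hN : 0 < N) (hD : ∀ i, 0 < D i)
    {a : SpinGroup (∑ i, D i)} (ha : spinCover _ a = 1) : a ∈ spinProduct D := by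
  rcases eq_one_or_neg_one_of_spinCover_eq_one ha with h | h
  · rw [show a = 1 from Subtype.ext h]
    exact one_mem _
  -- A single factor suffices: `-1` in that `Spin(D_i)`, with `1` in all the others, has product
  -- `-1`.
  · let i : Fin N := ⟨0, hN⟩
    refine ⟨Pi.mulSingle i ⟨-1, neg_one_mem_spinGroup (hD i)⟩, Subtype.ext ?_⟩
    rw [spinProductHom, MonoidHom.noncommPiCoprod_mulSingle, h]
    change CliffordAlgebra.map _ (-1) = _
    rw [map_neg, map_one]

/-- The preimage of the block diagonal matrices under the covering is `Spin(D_1) ⋯ Spin(D_N)`. -/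
theorem mem_spinProduct_of_spinCover_mem (hN : 0 < N) (hD : ∀ i, 0 < D i)
    {a : SpinGroup (∑ i, D i)} (ha : spinCover _ a ∈ soProduct D) : a ∈ spinProduct D := by
  obtain ⟨A, hA⟩ := ha
  -- The blocks are lifted separately; the product of the lifts differs from `a` by an element of
  -- the kernel.
  choose x hx using fun i => spinCover_surjective (A i)
  have h : spinCover _ (spinProductHom D x) = spinCover _ a := by
    rw [spinCover_spinProductHom, ← hA]
    simp only [hx]
  have h' : (spinProductHom D x)⁻¹ * a ∈ spinProduct D :=
    mem_spinProduct_of_spinCover_eq_one D hN hD (by rw [map_mul, map_inv, h, inv_mul_cancel])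
  have := mul_mem (show spinProductHom D x ∈ spinProduct D from ⟨x, rfl⟩) h'
  rwa [mul_inv_cancel_left] at this

end blocks

/-! ### Smooth maps to `Spin` and `SO`, and local lifts through the covering. -/

section smoothness

variable {m : ℕ} {M : Type*} [TopologicalSpace M] [ChartedSpace (EuclideanSpace ℝ (Fin m)) M]

variable (m) in
/-- Smoothness on `U` of a map to a vector space, tested by all linear functionals. -/
def WeaklySmoothOn {V : Type*} [AddCommGroup V] [Module ℝ V] (f : M → V) (U : Set M) : Prop :=
  ∀ φ : V →ₗ[ℝ] ℝ, ContMDiffOn (𝓡 m) 𝓘(ℝ, ℝ) ∞ (fun x => φ (f x)) U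

namespace WeaklySmoothOn

variable {V W : Type*} [AddCommGroup V] [Module ℝ V] [AddCommGroup W] [Module ℝ W]
  {f g : M → V} {U : Set M}

theorem const (v : V) : WeaklySmoothOn m (fun _ : M => v) U := fun _ => contMDiffOn_const

theorem congr (hf : WeaklySmoothOn m f U) (h : ∀ x ∈ U, g x = f x) : WeaklySmoothOn m g U :=
  fun φ => (hf φ).congr fun x hx => by rw [h x hx]

theorem linearMap (hf : WeaklySmoothOn m f U) (T : V →ₗ[ℝ] W) :
    WeaklySmoothOn m (fun x => T (f x)) U := fun φ => hf (φ ∘ₗ T)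

theorem sub (hf : WeaklySmoothOn m f U) (hg : WeaklySmoothOn m g U) :
    WeaklySmoothOn m (fun x => f x - g x) U := fun φ => by
  simpa only [map_sub] using (hf φ).sub (hg φ)

theorem sum {ι : Type*} {s : Finset ι} {f : ι → M → V} (hf : ∀ i ∈ s, WeaklySmoothOn m (f i) U) :
    WeaklySmoothOn m (fun x => ∑ i ∈ s, f i x) U := fun φ => by
  simpa only [map_sum] using contMDiffOn_finsetSum fun i hi => hf i hi φ

theorem smul {c : M → ℝ} (hc : ContMDiffOn (𝓡 m) 𝓘(ℝ, ℝ) ∞ c U) (hf : WeaklySmoothOn m f U) :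
    WeaklySmoothOn m (fun x => c x • f x) U := fun φ => by
  simp only [map_smul]
  exact hc.smul (hf φ)

/-- Expanding the first factor in a finite basis turns the product into a sum of smooth coefficients
times linear images of `g`. -/
theorem mul {A : Type*} [Ring A] [Algebra ℝ A] [FiniteDimensional ℝ A] {f g : M → A}
    (hf : WeaklySmoothOn m f U) (hg : WeaklySmoothOn m g U) :
    WeaklySmoothOn m (fun x => f x * g x) U := by
  let b := Module.finBasis ℝ A
  have h : WeaklySmoothOn m (fun x => ∑ i, b.coord i (f x) • (b i * g x)) U :=
    sum fun i _ => smul (hf (b.coord i)) (hg.linearMap (LinearMap.mulLeft ℝ (b i)))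
  refine h.congr fun x _ => ?_
  simp only [← smul_mul_assoc, ← Finset.sum_mul, Module.Basis.coord_apply, b.sum_repr]

theorem of_matrix {p q : ℕ} {A : M → Matrix (Fin p) (Fin q) ℝ}
    (hA : ∀ i j, ContMDiffOn (𝓡 m) 𝓘(ℝ, ℝ) ∞ (fun x => A x i j) U) : WeaklySmoothOn m A U := by
  have h : WeaklySmoothOn m
      (fun x => ∑ i, ∑ j, A x i j • (Matrix.single i j 1 : Matrix (Fin p) (Fin q) ℝ)) U :=
    sum fun i _ => sum fun j _ => smul (hA i j) (const _)
  refine h.congr fun x _ => ?_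
  conv_lhs => rw [Matrix.matrix_eq_sum_single (A x)]
  simp

end WeaklySmoothOn

theorem SmoothIntoGroup.mono {G : Type*} [SmoothCoordinates G] {h : M → G} {U V : Set M}
    (hh : SmoothIntoGroup m h U) (hVU : V ⊆ U) : SmoothIntoGroup m h V :=
  fun c hc => (hh c hc).mono hVU

theorem SmoothIntoGroup.congr {G : Type*} [SmoothCoordinates G] {h k : M → G} {U : Set M}
    (hh : SmoothIntoGroup m h U) (hk : ∀ x ∈ U, k x = h x) : SmoothIntoGroup m k U :=
  fun c hc => (hh c hc).congr fun x hx => by rw [hk x hx]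

theorem smoothIntoGroup_of_locally {G : Type*} [SmoothCoordinates G] {h : M → G} {U : Set M}
    (hh : ∀ x ∈ U, ∃ W, IsOpen W ∧ x ∈ W ∧ SmoothIntoGroup m h (U ∩ W)) :
    SmoothIntoGroup m h U := fun c hc =>
  contMDiffOn_of_locally_contMDiffOn fun x hx =>
    let ⟨W, hW, hxW, hs⟩ := hh x hx
    ⟨W, hW, hxW, hs c hc⟩

theorem smoothIntoGroup_spin_iff {n : ℕ} {h : M → SpinGroup n} {U : Set M} :
    SmoothIntoGroup m h U ↔
      WeaklySmoothOn m (fun x => (h x : CliffordAlgebra (stdForm n))) U :=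
  ⟨fun hh φ => hh _ ⟨φ, rfl⟩, by rintro hh _ ⟨φ, rfl⟩; exact hh φ⟩

theorem smoothIntoGroup_so_iff {n : ℕ} {h : M → SOGroup n} {U : Set M} :
    SmoothIntoGroup m h U ↔
      WeaklySmoothOn m (fun x => (h x : Matrix (Fin n) (Fin n) ℝ)) U :=
  ⟨fun hh φ => hh _ ⟨φ, rfl⟩, by rintro hh _ ⟨φ, rfl⟩; exact hh φ⟩

theorem smoothIntoGroup_subgroup_iff {G : Type*} [Group G] [SmoothCoordinates G] {K : Subgroup G}
    {h : M → K} {U : Set M} :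
    SmoothIntoGroup m h U ↔ SmoothIntoGroup m (fun x => (h x : G)) U :=
  ⟨fun hh c hc => hh _ ⟨c, hc, rfl⟩, by rintro hh _ ⟨c, hc, rfl⟩; exact hh c hc⟩

variable (m M) in
/-- Products of smooth maps from the `m`-manifold `M` to `G` are smooth. -/
def HasSmoothMul (G : Type*) [Group G] [SmoothCoordinates G] : Prop :=
  ∀ (U : Set M) (h k : M → G), SmoothIntoGroup m h U → SmoothIntoGroup m k U →
    SmoothIntoGroup m (fun x => h x * k x) U

theorem hasSmoothMul_spin (n : ℕ) : HasSmoothMul m M (SpinGroup n) := fun _ _ _ hh hk =>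
  smoothIntoGroup_spin_iff.2
    ((smoothIntoGroup_spin_iff.1 hh).mul (smoothIntoGroup_spin_iff.1 hk))

theorem hasSmoothMul_so (n : ℕ) : HasSmoothMul m M (SOGroup n) := fun _ _ _ hh hk =>
  smoothIntoGroup_so_iff.2 ((smoothIntoGroup_so_iff.1 hh).mul (smoothIntoGroup_so_iff.1 hk))

theorem HasSmoothMul.subgroup {G : Type*} [Group G] [SmoothCoordinates G]
    (hG : HasSmoothMul m M G) (K : Subgroup G) : HasSmoothMul m M K := fun _ _ _ hh hk =>
  smoothIntoGroup_subgroup_iff.2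
    (hG _ _ _ (smoothIntoGroup_subgroup_iff.1 hh) (smoothIntoGroup_subgroup_iff.1 hk))

theorem WeaklySmoothOn.star {n : ℕ} {f : M → CliffordAlgebra (stdForm n)} {U : Set M}
    (hf : WeaklySmoothOn m f U) : WeaklySmoothOn m (fun x => star (f x)) U :=
  hf.linearMap (reverse ∘ₗ involute.toLinearMap)

/-- The covering `Spin(n) → SO(n)` is smooth. -/
theorem SmoothIntoGroup.spinCover {n : ℕ} {h : M → SpinGroup n} {U : Set M}
    (hh : SmoothIntoGroup m h U) : SmoothIntoGroup m (fun x => spinCover n (h x)) U := by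
  rw [smoothIntoGroup_spin_iff] at hh
  rw [smoothIntoGroup_so_iff]
  -- A linear retraction onto the vectors makes each matrix entry a linear functional of `h e_j h*`.
  obtain ⟨π, hπ⟩ := (ι (stdForm n)).exists_leftInverse_of_injective
    (LinearMap.ker_eq_bot.2 clifford_ι_injective)
  refine WeaklySmoothOn.of_matrix fun i j => ?_
  have h1 := ((hh.mul (.const (ι (stdForm n) (Pi.single j 1)))).mul hh.star)
    (LinearMap.proj i ∘ₗ π)
  refine h1.congr fun x _ => ?_
  have h2 : (h x : CliffordAlgebra (stdForm n)) * ι (stdForm n) (Pi.single j 1) *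
      Star.star (h x : CliffordAlgebra (stdForm n)) =
      ι (stdForm n) (spinConj (h x) (Pi.single j 1)) := (ι_spinConj _ _).symm
  have h3 : π (ι (stdForm n) (spinConj (h x) (Pi.single j 1))) =
      spinConj (h x) (Pi.single j 1) := LinearMap.congr_fun hπ _
  exact ((LinearMap.toMatrix'_apply _ _ _).trans (congrFun h3 i).symm).trans
    (congrArg (LinearMap.proj i ∘ₗ π) h2).symm

theorem WeaklySmoothOn.twistedAverage {n : ℕ} {U : Set M}
    {a : M → Fin n → CliffordAlgebra (stdForm n)} (ha : ∀ j, WeaklySmoothOn m (fun x => a x j) U)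
    (l : List (Fin n)) {y : M → CliffordAlgebra (stdForm n)} (hy : WeaklySmoothOn m y U) :
    WeaklySmoothOn m (fun x => twistedAverage (a x) l (y x)) U := by
  induction l generalizing y with
  | nil => exact hy
  | cons j l ih =>
    exact ih (.smul contMDiffOn_const (hy.sub (((ha j).mul hy).mul (.const _))))

theorem WeaklySmoothOn.spinLift {n : ℕ} {U : Set M} {A : M → Matrix (Fin n) (Fin n) ℝ}
    (hA : WeaklySmoothOn m A U) : WeaklySmoothOn m (fun x => spinLift (A x)) U :=
  .twistedAverage (fun j => .sum fun i _ => .smul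
    (hA (Matrix.entryLinearMap ℝ ℝ i j)) (.const _)) _ (.const _)

theorem spinCover_neg_one {n : ℕ} (hn : 0 < n) :
    spinCover n ⟨-1, neg_one_mem_spinGroup hn⟩ = 1 := by
  refine Subtype.ext (Matrix.toLin'.injective (LinearMap.ext fun v => ?_))
  rw [Matrix.toLin'_apply, Matrix.toLin'_apply, spinCover_mulVec]
  apply clifford_ι_injective
  rw [ι_spinConj, ← spinGroup.star_eq_inv, spinGroup.coe_star]
  simp

/-- An element of `SO(n)` at which `spinLift` does not vanish is covered by the normalization of
`spinLift`. -/
theorem exists_spin_eq_normalized_spinLift {n : ℕ} (hn : 0 < n) (A : SOGroup n) {r : ℝ}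
    (hr : 0 < r) (h : spinLift (A : Matrix (Fin n) (Fin n) ℝ) *
      star (spinLift (A : Matrix (Fin n) (Fin n) ℝ)) = algebraMap ℝ _ r) :
    ∃ g : SpinGroup n, (g : CliffordAlgebra (stdForm n)) =
      (√r)⁻¹ • spinLift (A : Matrix (Fin n) (Fin n) ℝ) ∧ spinCover n g = A := by
  obtain ⟨g, rfl⟩ := spinCover_surjective A
  obtain ⟨c, hc⟩ := spinLift_spinCover g
  rw [hc, mul_star_smul_spin] at h
  obtain rfl := FaithfulSMul.algebraMap_injective _ _ h
  have hc0 : c ≠ 0 := fun h0 => by simp [h0] at hr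
  rw [Real.sqrt_mul_self_eq_abs, hc, smul_smul]
  -- Here `√r = |c|`, so the normalization is `g` or `-g` according to the sign of `c`; both cover
  -- the same matrix.
  rcases abs_choice c with h1 | h1
  · exact ⟨g, by rw [h1, inv_mul_cancel₀ hc0, one_smul], rfl⟩
  · refine ⟨⟨-1, neg_one_mem_spinGroup hn⟩ * g, ?_, by rw [map_mul, spinCover_neg_one hn, one_mul]⟩
    rw [h1, ← neg_inv, neg_mul, inv_mul_cancel₀ hc0, neg_smul, one_smul]
    change -1 * (g : CliffordAlgebra (stdForm n)) = _
    rw [neg_one_mul]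

/-- Here `r = c²`, possibly zero. Having it for every matrix gives a globally defined function,
whose positivity marks where normalization works. -/
theorem exists_spinLift_mul_star {n : ℕ} (A : SOGroup n) :
    ∃ r : ℝ, spinLift (A : Matrix (Fin n) (Fin n) ℝ) *
      star (spinLift (A : Matrix (Fin n) (Fin n) ℝ)) = algebraMap ℝ _ r := by
  obtain ⟨g, rfl⟩ := spinCover_surjective A
  obtain ⟨c, hc⟩ := spinLift_spinCover g
  exact ⟨c * c, by rw [hc, mul_star_smul_spin]⟩

/-- Smooth maps to `SO(n)` lift locally to smooth maps to `Spin(n)`. -/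
theorem SmoothIntoGroup.exists_local_lift {n : ℕ} (hn : 0 < n) {h : M → SOGroup n} {U : Set M}
    (hU : IsOpen U) (hh : SmoothIntoGroup m h U) {x₀ : M} (hx₀ : x₀ ∈ U) :
    ∃ W, IsOpen W ∧ x₀ ∈ W ∧ W ⊆ U ∧ ∃ k : M → SpinGroup n, SmoothIntoGroup m k W ∧
      ∀ x ∈ W, _root_.spinCover n (k x) = h x := by
  obtain ⟨g₀, hg₀⟩ := spinCover_surjective (h x₀)
  -- Translation moves the value at `x₀` to the identity, where `spinLift` is `1`; the factor `g₀`
  -- undoes this at the end.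
  let A : M → SOGroup n := fun x => h x * (h x₀)⁻¹
  have hA : SmoothIntoGroup m A U :=
    hasSmoothMul_so n _ _ _ hh fun _ _ => contMDiffOn_const
  let y : M → CliffordAlgebra (stdForm n) := fun x => _root_.spinLift (A x).1
  have hy : WeaklySmoothOn m y U := (smoothIntoGroup_so_iff.1 hA).spinLift
  -- A linear functional that reads off scalars, used to see that `r` is smooth.
  obtain ⟨φ, hφ⟩ :=
    (Algebra.linearMap ℝ (CliffordAlgebra (stdForm n))).exists_leftInverse_of_injective
    (LinearMap.ker_eq_bot.2 (FaithfulSMul.algebraMap_injective _ _))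
  choose r hr using fun x => exists_spinLift_mul_star (A x)
  have hrφ : ∀ x, r x = φ (y x * Star.star (y x)) := fun x => by
    rw [hr]; exact (LinearMap.congr_fun hφ (r x)).symm
  have hrs : ContMDiffOn (𝓡 m) 𝓘(ℝ, ℝ) ∞ r U :=
    ((hy.mul hy.star) φ).congr fun x _ => hrφ x
  have hr₀ : r x₀ = 1 := by
    have h1 := hr x₀
    rw [show A x₀ = 1 from mul_inv_cancel _, OneMemClass.coe_one, spinLift_one, star_one, mul_one,
      ← map_one (algebraMap ℝ (CliffordAlgebra (stdForm n)))] at h1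
    exact (FaithfulSMul.algebraMap_injective _ _ h1).symm
  let W : Set M := U ∩ r ⁻¹' Set.Ioi 0
  have hWU : W ⊆ U := Set.inter_subset_left
  have hk : ∀ x, ∃ g : SpinGroup n, x ∈ W →
      (g : CliffordAlgebra (stdForm n)) = (√(r x))⁻¹ • y x ∧ _root_.spinCover n g = A x := by
    intro x
    by_cases hx : x ∈ W
    · obtain ⟨g, hg⟩ := exists_spin_eq_normalized_spinLift hn (A x) hx.2 (hr x)
      exact ⟨g, fun _ => hg⟩
    · exact ⟨1, fun h => absurd h hx⟩
  choose k hk using hk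
  refine ⟨W, hrs.continuousOn.isOpen_inter_preimage hU isOpen_Ioi, ⟨hx₀, ?_⟩, hWU,
    fun x => k x * g₀, hasSmoothMul_spin n _ _ _ ?_ fun _ _ => contMDiffOn_const, fun x hx => ?_⟩
  · simp [hr₀]
  · have hsqrt : ContMDiffOn (𝓡 m) 𝓘(ℝ, ℝ) ∞ (fun x => (√(r x))⁻¹) W :=
      ContMDiffOn.inv₀ (fun x hx => ContDiffAt.comp_contMDiffWithinAt
        (Real.contDiffAt_sqrt (ne_of_gt hx.2)) (hrs.mono hWU x hx))
        fun x hx => (Real.sqrt_pos.2 hx.2).ne'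
    exact smoothIntoGroup_spin_iff.2
      ((WeaklySmoothOn.smul hsqrt fun φ => (hy φ).mono hWU).congr fun x hx => (hk x hx).1)
  · rw [map_mul, (hk x hx).2, hg₀, inv_mul_cancel_right]

end smoothness

/-! ### Transition functions between oriented orthonormal frames. -/

section frameBundle

variable {n : ℕ} {M : Type*} [TopologicalSpace M] [ChartedSpace (EuclideanSpace ℝ (Fin n)) M]
  [IsManifold (𝓡 n) ∞ M] {g : RiemannianMetricOn n M} {o : ManifoldOrientation n M}

/-- Two oriented orthonormal frames of a tangent space differ by a matrix in `SO(n)`. -/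
theorem IsOrientedOrthonormal.exists_mul_eq {x : M} {e f : Fin n → TangentSpace (𝓡 n) x}
    (he : IsOrientedOrthonormal g o x e) (hf : IsOrientedOrthonormal g o x f) :
    ∃ A : SOGroup n, (fun j => ∑ i, (A : Matrix (Fin n) (Fin n) ℝ) i j • e i) = f := by
  obtain ⟨b, hb, hbo⟩ := he.positive
  obtain ⟨c, hc, hco⟩ := hf.positive
  have hsum : ∀ j, ∑ i, b.toMatrix f i j • e i = f j := fun j => by
    rw [← hb]; exact b.sum_toMatrix_smul_self f j
  have horth : (b.toMatrix f).transpose * b.toMatrix f = 1 := by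
    ext j k
    rw [Matrix.mul_apply, Matrix.one_apply, ← hf.orthonormal, ← hsum j, ← hsum k]
    simp [he.orthonormal, mul_comm]
  have hdet : 0 < (b.toMatrix f).det := by
    rw [← b.det_apply, ← hc]
    exact (b.orientation_eq_iff_det_pos c).1 (hbo.trans hco.symm)
  have hdet1 : (b.toMatrix f).det = 1 := by
    have h := congrArg Matrix.det horth
    rw [Matrix.det_mul, Matrix.det_transpose, Matrix.det_one] at h
    nlinarith
  exact ⟨⟨b.toMatrix f, Matrix.mem_specialOrthogonalGroup_iff.2
    ⟨(Matrix.mem_orthogonalGroup_iff' _ _).2 horth, hdet1⟩⟩, funext hsum⟩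

/-- The `i`-th vector of the frame `p`, as a tangent vector at `x`; it is zero unless `p` is a frame
at `x`. -/
def OrthonormalFrames.vectorAt (p : OrthonormalFrames g o) (x : M) (i : Fin n) :
    TangentSpace (𝓡 n) x :=
  open Classical in if h : p.1 = x then h ▸ p.2.1 i else 0

theorem OrthonormalFrames.mk_vectorAt {p : OrthonormalFrames g o} {x : M} (h : p.1 = x)
    (i : Fin n) : (⟨x, p.vectorAt x i⟩ : TangentBundle (𝓡 n) M) = ⟨p.1, p.2.1 i⟩ := by
  subst h
  simp [vectorAt]

/-- Pairing the `j`-th vector of `p · A` with the orthonormal frame `p` recovers column `j` of `A`.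
This yields both freeness of the action and smoothness of the transition matrices. -/
theorem frameBundle_act_apply {p q : OrthonormalFrames g o} {A : SOGroup n}
    (h : (frameBundle g o).act p A = q) {x : M} (hp : p.1 = x) (i j : Fin n) :
    (A : Matrix (Fin n) (Fin n) ℝ) i j = g.inner x (p.vectorAt x i) (q.vectorAt x j) := by
  subst hp h
  simp [OrthonormalFrames.vectorAt, frameBundle, p.2.2.orthonormal]

theorem frameBundle_act_injective {p : OrthonormalFrames g o} {A A' : SOGroup n}
    (h : (frameBundle g o).act p A = (frameBundle g o).act p A') : A = A' := by
  refine Subtype.ext (Matrix.ext fun i j => ?_)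
  exact (frameBundle_act_apply h rfl i j).trans
    (frameBundle_act_apply (A := A') rfl rfl i j).symm

theorem frameBundle_exists_act {p q : OrthonormalFrames g o} (h : p.1 = q.1) :
    ∃ A, (frameBundle g o).act p A = q := by
  obtain ⟨x, e, he⟩ := p
  obtain ⟨y, f, hf⟩ := q
  obtain rfl : x = y := h
  obtain ⟨A, rfl⟩ := he.exists_mul_eq hf
  exact ⟨A, rfl⟩

theorem contMDiffOn_metric {U : Set M} {v w : ∀ x : M, TangentSpace (𝓡 n) x}
    (hv : ContMDiffOn (𝓡 n) (𝓡 n).tangent ∞ (fun x => (⟨x, v x⟩ : TangentBundle (𝓡 n) M)) U)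
    (hw : ContMDiffOn (𝓡 n) (𝓡 n).tangent ∞ (fun x => (⟨x, w x⟩ : TangentBundle (𝓡 n) M)) U) :
    ContMDiffOn (𝓡 n) 𝓘(ℝ, ℝ) ∞ (fun x => g.inner x (v x) (w x)) U := by
  intro x hx
  -- The function is viewed as a section of the trivial line bundle, so that evaluation of the
  -- metric is evaluation of a bundle of bilinear maps.
  have h : ContMDiffWithinAt (𝓡 n) ((𝓡 n).prod 𝓘(ℝ)) ∞
      (fun y => Bundle.TotalSpace.mk' ℝ (E := Bundle.Trivial M ℝ) y
        (g.inner y (v y) (w y))) U x := by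
    apply ContMDiffWithinAt.clm_bundle_apply₂ (F₁ := EuclideanSpace ℝ (Fin n))
      (F₂ := EuclideanSpace ℝ (Fin n))
    · exact g.contMDiff.contMDiffAt.contMDiffWithinAt
    · exact hv x hx
    · exact hw x hx
  simp only [Bundle.contMDiffWithinAt_totalSpace] at h
  exact h.2

/-- Two smooth sections of the bundle of oriented orthonormal frames differ by a smooth map to
`SO(n)`. -/
theorem frameBundle_exists_smooth_act {σ τ : Set M × (M → OrthonormalFrames g o)}
    (hσ : σ ∈ (frameBundle g o).smoothSections) (hτ : τ ∈ (frameBundle g o).smoothSections) :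
    ∃ h : M → SOGroup n, SmoothIntoGroup n h (σ.1 ∩ τ.1) ∧
      ∀ x ∈ σ.1 ∩ τ.1, τ.2 x = (frameBundle g o).act (σ.2 x) (h x) := by
  obtain ⟨-, hσ1, hσ2⟩ := hσ
  obtain ⟨-, hτ1, hτ2⟩ := hτ
  have hex : ∀ x, ∃ A, x ∈ σ.1 ∩ τ.1 → τ.2 x = (frameBundle g o).act (σ.2 x) A := fun x => by
    by_cases hx : x ∈ σ.1 ∩ τ.1
    · obtain ⟨A, hA⟩ := frameBundle_exists_act ((hσ1 x hx.1).trans (hτ1 x hx.2).symm)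
      exact ⟨A, fun _ => hA.symm⟩
    · exact ⟨1, fun h => absurd h hx⟩
  choose h hh using hex
  refine ⟨h, smoothIntoGroup_so_iff.2 (WeaklySmoothOn.of_matrix fun i j => ?_), hh⟩
  refine (contMDiffOn_metric (g := g) (v := fun x => (σ.2 x).vectorAt x i)
    (w := fun x => (τ.2 x).vectorAt x j) ?_ ?_).congr
    fun x hx => frameBundle_act_apply (hh x hx).symm (hσ1 x hx.1) i j
  · exact ((hσ2 i).mono Set.inter_subset_left).congr fun x hx =>
      OrthonormalFrames.mk_vectorAt (hσ1 x hx.1) i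
  · exact ((hτ2 j).mono Set.inter_subset_right).congr fun x hx =>
      OrthonormalFrames.mk_vectorAt (hτ1 x hx.2) j

end frameBundle

/-! ### Principal bundles and their fibre products. -/

section principalBundles

variable {n : ℕ} {M : Type*} [TopologicalSpace M] [ChartedSpace (EuclideanSpace ℝ (Fin n)) M]

/-- A section is smooth if locally it differs from smooth sections by smooth maps to the group. -/
theorem IsPrincipalBundle.mem_smoothSections_of_locally {G P : Type*} [Group G]
    [SmoothCoordinates G] {B : PrincipalBundleData M G P} (hB : IsPrincipalBundle n B)
    (hG : HasSmoothMul n M G) {V : Set M} {t : M → P} (hV : IsOpen V)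
    (ht : ∀ x ∈ V, B.proj (t x) = x)
    (h : ∀ x ∈ V, ∃ σ ∈ B.smoothSections, ∃ W, IsOpen W ∧ x ∈ W ∧ W ⊆ σ.1 ∧ ∃ k : M → G,
      SmoothIntoGroup n k W ∧ ∀ y ∈ W, t y = B.act (σ.2 y) (k y)) :
    (V, t) ∈ B.smoothSections := by
  rw [hB.mem_smoothSections_iff V t hV ht]
  intro τ hτ
  have hex : ∀ y, ∃ a, y ∈ τ.1 ∩ V → t y = B.act (τ.2 y) a := fun y => by
    by_cases hy : y ∈ τ.1 ∩ V
    · obtain ⟨a, ha, -⟩ := hB.existsUnique_act (τ.2 y) (t y)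
        ((hB.proj_section τ hτ y hy.1).trans (ht y hy.2).symm)
      exact ⟨a, fun _ => ha.symm⟩
    · exact ⟨1, fun h => absurd h hy⟩
  choose l hl using hex
  refine ⟨l, smoothIntoGroup_of_locally fun x hx => ?_, hl⟩
  obtain ⟨σ, hσ, W, hW, hxW, hWσ, k, hk, hkt⟩ := h x hx.2
  obtain ⟨r, hr, hrσ⟩ := (hB.mem_smoothSections_iff σ.1 σ.2 (hB.isOpen σ hσ)
    (hB.proj_section σ hσ)).1 hσ τ hτ
  -- From `τ` to `σ` to `t` the transitions multiply to `r k`; by freeness this is `l` near `x`.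
  refine ⟨W, hW, hxW, (hG _ _ _ (hr.mono fun y hy => ⟨hy.1.1, hWσ hy.2⟩)
    (hk.mono Set.inter_subset_right)).congr fun y hy => ?_⟩
  have h1 : B.act (τ.2 y) (l y) = t y := (hl y hy.1).symm
  have h2 : B.act (τ.2 y) (r y * k y) = t y := by
    rw [hB.act_mul, ← hrσ y ⟨hy.1.1, hWσ hy.2⟩, hkt y hy.2]
  exact (hB.existsUnique_act (τ.2 y) (t y)
    ((hB.proj_section τ hτ y hy.1.1).trans (ht y hy.1.2).symm)).unique h1 h2

theorem proj_snd_eq_proj_fst {M G H P Q R : Type*} [Group G] [Group H] {φ : G →* H}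
    {K : Subgroup H} {B : PrincipalBundleData M G P} {C : PrincipalBundleData M K Q}
    {F : PrincipalBundleData M H R} {lam : P → R} {i : Q → R}
    (hlam : IsPrincipalMorphism φ B F lam)
    (hi : IsPrincipalMorphism K.subtype C F i) (z : {z : P × Q // lam z.1 = i z.2}) :
    C.proj z.1.2 = B.proj z.1.1 := by
  rw [← hi.proj_map, ← z.2, hlam.proj_map]

section fibreProduct

variable {G H P Q R : Type*} [Group G] [Group H] [SmoothCoordinates G] [SmoothCoordinates H]
  {φ : G →* H} {K : Subgroup H} {L : Subgroup G} {ψ : L →* K} {hψ : ∀ a : L, (ψ a : H) = φ a}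
  {B : PrincipalBundleData M G P} {C : PrincipalBundleData M K Q}
  {F : PrincipalBundleData M H R} {lam : P → R} {i : Q → R}
  {hlam : IsPrincipalMorphism φ B F lam} {hi : IsPrincipalMorphism K.subtype C F i}

/-- The group `L` acts simply transitively on the fibres of the fibre product if it is the
preimage of `K`. -/
theorem fibreProduct_existsUnique_act (hB : IsPrincipalBundle n B) (hC : IsPrincipalBundle n C)
    (hF : ∀ (p : R) (a b : H), F.act p a = F.act p b → a = b)
    (hL : ∀ a : G, φ a ∈ K → a ∈ L) (z w : {z : P × Q // lam z.1 = i z.2})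
    (hzw : B.proj z.1.1 = B.proj w.1.1) :
    ∃! a, (fibreProduct ψ hψ hlam hi).act z a = w := by
  obtain ⟨a, ha, hau⟩ := hB.existsUnique_act z.1.1 w.1.1 hzw
  obtain ⟨b, hb, -⟩ := hC.existsUnique_act z.1.2 w.1.2
    (by rw [proj_snd_eq_proj_fst hlam hi, hzw, proj_snd_eq_proj_fst hlam hi])
  -- Both `φ a` and `b` carry the common image of `z` in `F` to that of `w`, so freeness there
  -- identifies them and puts `a` into the preimage of `K`.
  have hab : φ a = b := hF (lam z.1.1) _ _ (by
    have h := hi.map_act z.1.2 b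
    rw [hb, ← w.2, ← z.2, ← ha, hlam.map_act] at h
    exact h)
  have haL : a ∈ L := hL a (hab ▸ b.2)
  refine ⟨⟨a, haL⟩, Subtype.ext (Prod.ext ha ?_), fun c hc => Subtype.ext (hau c ?_)⟩
  · have hψb : ψ ⟨a, haL⟩ = b := Subtype.ext ((hψ _).trans hab)
    change C.act z.1.2 (ψ ⟨a, haL⟩) = w.1.2
    rw [hψb, hb]
  · exact congrArg (fun z => z.1.1) hc

/-- Through every point of the base there is a smooth section of the fibre product. -/
theorem fibreProduct_exists_section (hB : IsPrincipalBundle n B) (hC : IsPrincipalBundle n C)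
    (hG : HasSmoothMul n M G) (hK : HasSmoothMul n M K)
    (hlift : ∀ σ ∈ F.smoothSections, ∀ τ ∈ F.smoothSections, ∀ x ∈ σ.1 ∩ τ.1, ∃ W, IsOpen W ∧
      x ∈ W ∧ W ⊆ σ.1 ∩ τ.1 ∧ ∃ k : M → G, SmoothIntoGroup n k W ∧
        ∀ y ∈ W, τ.2 y = F.act (σ.2 y) (φ (k y))) (x : M) :
    ∃ σ ∈ (fibreProduct ψ hψ hlam hi).smoothSections, x ∈ σ.1 := by
  obtain ⟨σ, hσ, hxσ⟩ := hB.exists_section x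
  obtain ⟨τ, hτ, hxτ⟩ := hC.exists_section x
  obtain ⟨W, hW, hxW, hWστ, k, hk, hkF⟩ := hlift _ (hlam.map_section σ hσ) _
    (hi.map_section τ hτ) x ⟨hxσ, hxτ⟩
  -- The lift `k` corrects `σ` so that, paired with `τ`, it lands in the fibre product.
  have hz : ∀ y ∈ W, lam (B.act (σ.2 y) (k y)) = i (τ.2 y) := fun y hy => by
    rw [hlam.map_act]; exact (hkF y hy).symm
  classical
  let t : M → {z : P × Q // lam z.1 = i z.2} := fun y =>
    if hy : y ∈ W then ⟨(B.act (σ.2 y) (k y), τ.2 y), hz y hy⟩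
    -- Off `W` any point of the fibre product will do; the value at `x` is one.
    else ⟨(B.act (σ.2 x) (k x), τ.2 x), hz x hxW⟩
  have ht1 : ∀ y ∈ W, (t y).1.1 = B.act (σ.2 y) (k y) := fun y hy => by simp [t, hy]
  have ht2 : ∀ y ∈ W, (t y).1.2 = τ.2 y := fun y hy => by simp [t, hy]
  refine ⟨(W, t), ⟨?_, ?_⟩, hxW⟩
  · refine hB.mem_smoothSections_of_locally hG hW (fun y hy => ?_) fun y hy =>
      ⟨σ, hσ, W, hW, hy, fun y hy => (hWστ hy).1, k, hk, ht1⟩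
    rw [ht1 y hy, hB.proj_act]
    exact hB.proj_section σ hσ y (hWστ hy).1
  · refine hC.mem_smoothSections_of_locally hK hW (fun y hy => ?_) fun y hy =>
      ⟨τ, hτ, W, hW, hy, fun y hy => (hWστ hy).2, fun _ => 1,
        fun _ _ => contMDiffOn_const, fun y hy => ?_⟩
    · rw [ht2 y hy]
      exact hC.proj_section τ hτ y (hWστ hy).2
    · rw [ht2 y hy, hC.act_one]

/-- The fibre product is a principal bundle for the preimage `L` of `K` if the sections of `F` differ
locally by smooth maps that lift to `G`. -/
theorem fibreProduct_isPrincipalBundle (hB : IsPrincipalBundle n B) (hC : IsPrincipalBundle n C)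
    (hG : HasSmoothMul n M G) (hK : HasSmoothMul n M K)
    (hF : ∀ (p : R) (a b : H), F.act p a = F.act p b → a = b)
    (hL : ∀ a : G, φ a ∈ K → a ∈ L)
    (hψs : ∀ (U : Set M) (h : M → L), SmoothIntoGroup n h U →
      SmoothIntoGroup n (fun x => ψ (h x)) U)
    (hlift : ∀ σ ∈ F.smoothSections, ∀ τ ∈ F.smoothSections, ∀ x ∈ σ.1 ∩ τ.1, ∃ W, IsOpen W ∧
      x ∈ W ∧ W ⊆ σ.1 ∩ τ.1 ∧ ∃ k : M → G, SmoothIntoGroup n k W ∧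
        ∀ y ∈ W, τ.2 y = F.act (σ.2 y) (φ (k y))) :
    IsPrincipalBundle n (fibreProduct ψ hψ hlam hi) where
  act_one z := Subtype.ext (Prod.ext (hB.act_one _) (by
    change C.act z.1.2 (ψ 1) = z.1.2
    rw [map_one, hC.act_one]))
  act_mul z a b := Subtype.ext (Prod.ext (hB.act_mul _ _ _) (by
    change C.act z.1.2 (ψ (a * b)) = C.act (C.act z.1.2 (ψ a)) (ψ b)
    rw [map_mul, hC.act_mul]))
  proj_act z a := hB.proj_act _ _
  existsUnique_act := fibreProduct_existsUnique_act hB hC hF hL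
  isOpen σ hσ := hB.isOpen _ hσ.1
  proj_section σ hσ := hB.proj_section _ hσ.1
  exists_section := fibreProduct_exists_section hB hC hG hK hlift
  mem_smoothSections_iff V t hV ht := by
    constructor
    · rintro ⟨ht1, -⟩ σ hσ
      obtain ⟨h, hh, hht⟩ := (hB.mem_smoothSections_iff V _ hV ht).1 ht1 _ hσ.1
      have hproj : ∀ y ∈ σ.1 ∩ V, B.proj (σ.2 y).1.1 = B.proj (t y).1.1 := fun y hy =>
        (hB.proj_section _ hσ.1 y hy.1).trans (ht y hy.2).symm
      have hex : ∀ y, ∃ a : L, y ∈ σ.1 ∩ V →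
          t y = (fibreProduct ψ hψ hlam hi).act (σ.2 y) a := fun y => by
        by_cases hy : y ∈ σ.1 ∩ V
        · obtain ⟨a, ha, -⟩ := fibreProduct_existsUnique_act (hψ := hψ) (hlam := hlam) (hi := hi)
            hB hC hF hL (σ.2 y) (t y) (hproj y hy)
          exact ⟨a, fun _ => ha.symm⟩
        · exact ⟨1, fun h => absurd h hy⟩
      choose l hl using hex
      -- By freeness on `B`, the `L`-valued transition agrees in `G` with that of the first
      -- components, so it inherits smoothness.
      refine ⟨l, smoothIntoGroup_subgroup_iff.2 (hh.congr fun y hy => ?_), hl⟩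
      exact (hB.existsUnique_act _ _ (hproj y hy)).unique
        (congrArg (fun z => z.1.1) (hl y hy)).symm (hht y hy).symm
    · intro h
      -- Smooth sections of the fibre product cover `V`; projecting their transitions to `t` shows
      -- each component of `t` to be locally smooth.
      have hloc : ∀ x ∈ V, ∃ σ ∈ (fibreProduct ψ hψ hlam hi).smoothSections, x ∈ σ.1 ∩ V ∧
          IsOpen (σ.1 ∩ V) ∧ ∃ k : M → L, SmoothIntoGroup n k (σ.1 ∩ V) ∧
            ∀ y ∈ σ.1 ∩ V, t y = (fibreProduct ψ hψ hlam hi).act (σ.2 y) (k y) := fun x hx => by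
        obtain ⟨σ, hσ, hxσ⟩ := fibreProduct_exists_section (hψ := hψ) (hlam := hlam) (hi := hi)
          hB hC hG hK hlift x
        exact ⟨σ, hσ, ⟨hxσ, hx⟩, (hB.isOpen _ hσ.1).inter hV, h σ hσ⟩
      constructor
      · refine hB.mem_smoothSections_of_locally hG hV ht fun x hx => ?_
        obtain ⟨σ, hσ, hxσ, ho, k, hk, hkt⟩ := hloc x hx
        exact ⟨_, hσ.1, _, ho, hxσ, Set.inter_subset_left, fun y => k y,
          smoothIntoGroup_subgroup_iff.1 hk, fun y hy => congrArg (fun z => z.1.1) (hkt y hy)⟩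
      · refine hC.mem_smoothSections_of_locally hK hV
          (fun x hx => (proj_snd_eq_proj_fst hlam hi _).trans (ht x hx)) fun x hx => ?_
        obtain ⟨σ, hσ, hxσ, ho, k, hk, hkt⟩ := hloc x hx
        exact ⟨_, hσ.2, _, ho, hxσ, Set.inter_subset_left, fun y => ψ (k y), hψs _ _ hk,
          fun y hy => congrArg (fun z => z.1.2) (hkt y hy)⟩

end fibreProduct

end principalBundles

end

theorem proposition2 {N : ℕ} (hN : 0 < N) (D : Fin N → ℕ) (hD : ∀ i, 0 < D i)
    {M : Type*} [TopologicalSpace M] [ChartedSpace (EuclideanSpace ℝ (Fin (∑ i, D i))) M]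
    [IsManifold (𝓡 (∑ i, D i)) ∞ M]
    (g : RiemannianMetricOn (∑ i, D i) M) (o : ManifoldOrientation (∑ i, D i) M)
    {P Q : Type*} (B : PrincipalBundleData M (SpinGroup (∑ i, D i)) P)
    (lam : P → OrthonormalFrames g o) (hlam : IsSpinStructure g o B lam)
    (C : PrincipalBundleData M (soProduct D) Q)
    (incl : Q → OrthonormalFrames g o)
    (hi : IsReduction (∑ i, D i) (soProduct D) C (frameBundle g o) incl) :
    IsReduction (∑ i, D i) (spinProduct D)
        (fibreProduct (spinProductCover D) (fun _ => rfl) hlam.isPrincipalMorphism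
          hi.isPrincipalMorphism)
        B (fun z => z.1.1) ∧
      IsPrincipalMorphism (spinProductCover D)
        (fibreProduct (spinProductCover D) (fun _ => rfl) hlam.isPrincipalMorphism
          hi.isPrincipalMorphism)
        C (fun z => z.1.2) := by
  have hpos : 0 < ∑ i, D i := Finset.sum_pos (fun i _ => hD i) ⟨⟨0, hN⟩, Finset.mem_univ _⟩
  -- Both projections are smooth and equivariant by construction, since a section of the fibre
  -- product is smooth exactly when its components are. Only the bundle axioms remain.
  refine ⟨⟨?_, fun _ => rfl, fun _ _ => rfl, fun σ hσ => hσ.1⟩,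
    proj_snd_eq_proj_fst hlam.isPrincipalMorphism hi.isPrincipalMorphism, fun _ _ => rfl,
    fun σ hσ => hσ.2⟩
  refine fibreProduct_isPrincipalBundle hlam.isPrincipalBundle hi.isPrincipalBundle
    (hasSmoothMul_spin _) ((hasSmoothMul_so _).subgroup _)
    (fun _ _ _ => frameBundle_act_injective)
    (fun _ => mem_spinProduct_of_spinCover_mem D hN hD)
    (fun _ _ hh => smoothIntoGroup_subgroup_iff.2 (smoothIntoGroup_subgroup_iff.1 hh).spinCover)
    fun σ hσ τ hτ x hx => ?_
  obtain ⟨h, hh, hht⟩ := frameBundle_exists_smooth_act hσ hτ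
  obtain ⟨W, hW, hxW, hWU, k, hk, hkh⟩ := hh.exists_local_lift hpos (hσ.1.inter hτ.1) hx
  exact ⟨W, hW, hxW, hWU, k, hk, fun y hy => by rw [hkh y hy, hht y (hWU hy)]⟩
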